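/- **Setting.** For $\alpha,\beta\ge 0$ let $h=-\Delta\otimes 1+\alpha\,\overline{(D^-\otimes S^+-D^+\otimes S^-)}+2\beta\,(1\otimes S^3)$ be the self-adjoint Rashba operator in $L^2(\mathbb R^3)\otimes\mathbb C^2$ with domain $H^2(\mathbb R^3)\otimes\mathbb C^2$, where $D^\pm=\nabla_1\pm i\nabla_2$, $S^i=\tfrac12\sigma^i$ with the Pauli matrices $\sigma^i$, and $S^\pm=S^1\pm iS^2$. Let $H=h\otimes 1+1\otimes h$ be the two-particle operator and $R(z)=(H-z)^{-1}$. Write $q=(x_1,x_2)\in\mathbb R^6$ and $Q=Kq=(x,X)$ with $x=x_1-x_2$, $X=\tfrac12(x_1+x_2)$, and let $(\mathcal Uf)(q)=f(Kq)$ on $L^2(\mathbb R^6)$. Let $|\sigma\rangle=|Ss\rangle$, with $S\in\{0,1\}$ and $s\in\{-S,\dots,S\}$, be the coupled-spin basis of $\mathbb C^2\otimes\mathbb C^2\cong\mathbb C^3\oplus\mathbb C^1$ given by the Clebsch–Gordan coefficients of $SU(2)$, and let $L$ be the unitary map $$L\colon (u\otimes|s_1\rangle)\otimes(v\otimes|s_2\rangle)\mapsto\sum_{S,s}\begin{bmatrix}\tfrac12&\tfrac12&S\\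 s_1&s_2&s\end{bmatrix}\,u(x)v(X)\otimes|Ss\rangle ,$$ where $u(x)v(X)$ denotes $\mathcal U(u\otimes v)$, that is, the function $q\mapsto u(x_1-x_2)\,v(\tfrac12(x_1+x_2))$. Put $R^c(z)=LR(z)L^*$. The Green function $(R^c_{\sigma'\sigma}(z))_{\sigma',\sigma}$ is the family of locally integrable functions on $\mathbb R^6$ such that, for all $f\in L^2(\mathbb R^6)$ and all $\sigma$, $$R^c(z)\bigl(f(Q)\otimes|\sigma\rangle\bigr)=\sum_{\sigma'}\mathop{\mathrm{l.i.m.}}_{r\to\infty}\int_{|Q'|\le r}R^c_{\sigma'\sigma}(z)(Q-Q')\,f(Q')\,dQ'\otimes|\sigma'\rangle ,\qquad Q=Kq,$$ where l.i.m. is the limit in $L^2(\mathbb R^6)$ and a function of $Q=Kq$ is read as a function of $q$ (so $f(Q)$ stands for $\mathcal Uf$). Further, $|Q|^2=Q^2=|x|^2+|X|^2$, $\sqrt{\cdot}$ is the principal square root, and $K_\nu(w)=\int_0^\infty e^{-w\cosh t}\cosh(\nu t)\,dt$ ($\operatorname{Re}w>0$) is the Macdonald function. **Proposition.** Let $\alpha=0$,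 $\beta\ge0$ and $\operatorname{Im}z\ne0$. Then $R(z)$ exists as a bounded operator, the Green function exists and is unique up to null sets, and for all $\sigma'$, all $\sigma=(S,s)$ and a.e. $Q\in\mathbb R^6$ $$R^c_{\sigma'\sigma}(z)(Q)=-\frac{\delta_{\sigma'\sigma}}{8\pi^3Q^2}\Bigl(\delta_{s0}\,zK_2(|Q|\sqrt{-z})+\delta_{S1}\bigl[\delta_{s1}(z-2\beta)K_2(|Q|\sqrt{2\beta-z})+\delta_{s,-1}(z+2\beta)K_2(|Q|\sqrt{-2\beta-z})\bigr]\Bigr).$$ If in addition $\beta=0$, then for all $\sigma',\sigma$ and a.e. $Q\in\mathbb R^6$ $$R^c_{\sigma'\sigma}(z)(Q)=-\delta_{\sigma'\sigma}\,\frac{zK_2(|Q|\sqrt{-z})}{8\pi^3Q^2}.$$ -/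

import Mathlib

namespace Rashba

noncomputable section

open MeasureTheory Filter Topology Complex
open scoped ENNReal SchwartzMap LineDeriv Laplacian

/-! ### The single-particle Hilbert space and the spin operators -/

/-- Position space `ℝ³`. -/
abbrev R3 := EuclideanSpace ℝ (Fin 3)

/-- `L²(ℝ³)`. -/
abbrev L2R3 := Lp ℂ 2 (volume : Measure R3)

/-- Spin labels: `0` stands for `s = 1/2` and `1` stands for `s = -1/2`. -/
abbrev Spin := Fin 2

/-- The Hilbert space `L²(ℝ³) ⊗ ℂ²`, written in components with respect to the standard basis
`|1/2⟩ = (1,0)`, `|-1/2⟩ = (0,1)` of `ℂ²`. -/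
abbrev OneParticle := PiLp 2 (fun _ : Spin => L2R3)

/-- The Pauli matrices. -/
def pauli : Fin 3 → Matrix Spin Spin ℂ :=
  ![!![0, 1; 1, 0], !![0, -I; I, 0], !![1, 0; 0, -1]]

/-- The spin operators `S^1, S^2, S^3`. -/
def spinOp (i : Fin 3) : Matrix Spin Spin ℂ := (1 / 2 : ℂ) • pauli i

/-- `S⁺ = S^1 + i S^2`. -/
def spinUp : Matrix Spin Spin ℂ := spinOp 0 + I • spinOp 1

/-- `S⁻ = S^1 - i S^2`. -/
def spinDown : Matrix Spin Spin ℂ := spinOp 0 - I • spinOp 1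

/-! ### The single-particle Rashba operator -/

/-- An `L²` function regarded as a tempered distribution. -/
def toDistr (u : L2R3) : 𝓢'(R3, ℂ) := (u : 𝓢'(R3, ℂ))

/-- The partial derivative `∇ᵢ` in the sense of distributions. -/
def pd (i : Fin 3) (T : 𝓢'(R3, ℂ)) : 𝓢'(R3, ℂ) :=
  ∂_{(EuclideanSpace.single i 1 : R3)} T

/-- `D⁺ = ∇₁ + i ∇₂`. -/
def Dplus (T : 𝓢'(R3, ℂ)) : 𝓢'(R3, ℂ) := pd 0 T + I • pd 1 T

/-- `D⁻ = ∇₁ - i ∇₂`. -/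
def Dminus (T : 𝓢'(R3, ℂ)) : 𝓢'(R3, ℂ) := pd 0 T - I • pd 1 T

/-- Component `s` of the differential expression
`-Δ ⊗ 1 + α (D⁻ ⊗ S⁺ - D⁺ ⊗ S⁻) + β (2 · 1 ⊗ S³)` applied to `u`. -/
def rashbaExpr (α β : ℝ) (u : OneParticle) (s : Spin) : 𝓢'(R3, ℂ) :=
  - Δ (toDistr (u s))
    + (α : ℂ) • ∑ s', (spinUp s s' • Dminus (toDistr (u s'))
        - spinDown s s' • Dplus (toDistr (u s')))
    + (β : ℂ) • ∑ s', (2 * spinOp 2 s s') • toDistr (u s')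

theorem toDistr_zero : toDistr 0 = 0 :=
  (Lp.toTemperedDistributionCLM ℂ (volume : Measure R3) 2).map_zero

theorem toDistr_add (u v : L2R3) : toDistr (u + v) = toDistr u + toDistr v :=
  (Lp.toTemperedDistributionCLM ℂ (volume : Measure R3) 2).map_add u v

theorem toDistr_smul (c : ℂ) (u : L2R3) : toDistr (c • u) = c • toDistr u :=
  (Lp.toTemperedDistributionCLM ℂ (volume : Measure R3) 2).map_smul c u

theorem rashbaExpr_zero (α β : ℝ) (s : Spin) : rashbaExpr α β 0 s = 0 := by
  have h := (LineDeriv.laplacianCLM ℂ R3 𝓢'(R3, ℂ)).map_zero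
  have hp : ∀ i, pd i 0 = 0 := fun i =>
    (LineDeriv.lineDerivOpCLM ℂ 𝓢'(R3, ℂ) (EuclideanSpace.single i 1 : R3)).map_zero
  rw [TemperedDistribution.laplacianCLM_apply] at h
  simp only [rashbaExpr, Dplus, Dminus, PiLp.zero_apply, toDistr_zero, h, hp, Fin.sum_univ_two]
  module

theorem rashbaExpr_add (α β : ℝ) (u v : OneParticle) (s : Spin) :
    rashbaExpr α β (u + v) s = rashbaExpr α β u s + rashbaExpr α β v s := by
  have h := fun a b => (LineDeriv.laplacianCLM ℂ R3 𝓢'(R3, ℂ)).map_add a b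
  have hp : ∀ i a b, pd i (a + b) = pd i a + pd i b := fun i a b =>
    (LineDeriv.lineDerivOpCLM ℂ 𝓢'(R3, ℂ) (EuclideanSpace.single i 1 : R3)).map_add a b
  simp only [TemperedDistribution.laplacianCLM_apply] at h
  simp only [rashbaExpr, Dplus, Dminus, PiLp.add_apply, toDistr_add, h, hp, Fin.sum_univ_two]
  module

theorem rashbaExpr_smul (α β : ℝ) (c : ℂ) (u : OneParticle) (s : Spin) :
    rashbaExpr α β (c • u) s = c • rashbaExpr α β u s := by
  have h := fun a => (LineDeriv.laplacianCLM ℂ R3 𝓢'(R3, ℂ)).map_smul c a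
  have hp : ∀ i a, pd i (c • a) = c • pd i a := fun i a =>
    (LineDeriv.lineDerivOpCLM ℂ 𝓢'(R3, ℂ) (EuclideanSpace.single i 1 : R3)).map_smul c a
  simp only [TemperedDistribution.laplacianCLM_apply] at h
  simp only [rashbaExpr, Dplus, Dminus, PiLp.smul_apply, toDistr_smul, h, hp, Fin.sum_univ_two]
  module

/-- The graph of the Rashba operator: pairs `(u, w)` with `u ∈ H²(ℝ³) ⊗ ℂ²` and `w` the `L²`
function representing the differential expression applied to `u`. -/
def rashbaGraph (α β : ℝ) : Submodule ℂ (OneParticle × OneParticle) where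
  carrier := {p | (∀ s, TemperedDistribution.MemSobolev 2 2 (toDistr (p.1 s))) ∧
    ∀ s, toDistr (p.2 s) = rashbaExpr α β p.1 s}
  zero_mem' := by
    refine ⟨fun s => ?_, fun s => ?_⟩
    · change TemperedDistribution.MemSobolev 2 2 (toDistr 0)
      rw [toDistr_zero]
      exact TemperedDistribution.memSobolev_fun_zero ..
    · change toDistr 0 = rashbaExpr α β 0 s
      rw [toDistr_zero, rashbaExpr_zero]
  add_mem' := by
    rintro a b ⟨ha, ha'⟩ ⟨hb, hb'⟩
    refine ⟨fun s => ?_, fun s => ?_⟩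
    · change TemperedDistribution.MemSobolev 2 2 (toDistr (a.1 s + b.1 s))
      rw [toDistr_add]
      exact (ha s).add (hb s)
    · change toDistr (a.2 s + b.2 s) = rashbaExpr α β (a.1 + b.1) s
      rw [toDistr_add, rashbaExpr_add, ha', hb']
  smul_mem' := by
    rintro c a ⟨ha, ha'⟩
    refine ⟨fun s => ?_, fun s => ?_⟩
    · change TemperedDistribution.MemSobolev 2 2 (toDistr (c • a.1 s))
      rw [toDistr_smul]
      exact (ha s).smul c
    · change toDistr (c • a.2 s) = rashbaExpr α β (c • a.1) s
      rw [toDistr_smul, rashbaExpr_smul, ha']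

/-- The Rashba spin-orbit coupled operator `h = h⁰ + α Uˢᵒ + β Uᴮ` in `L²(ℝ³) ⊗ ℂ²` with domain
`dom h = dom h⁰ = H²(ℝ³) ⊗ ℂ²`. -/
def rashba (α β : ℝ) : OneParticle →ₗ.[ℂ] OneParticle := (rashbaGraph α β).toLinearPMap

/-! ### The two-particle operator -/

/-- `ℝ⁶ = ℝ³ × ℝ³` with its Euclidean norm. -/
abbrev R6 := WithLp 2 (R3 × R3)

/-- `L²(ℝ⁶)`. -/
abbrev L2R6 := Lp ℂ 2 (volume : Measure R6)

/-- The Hilbert tensor product `(L²(ℝ³) ⊗ ℂ²) ⊗ (L²(ℝ³) ⊗ ℂ²)`, realised as `L²(ℝ⁶)`-valued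
families indexed by the spins `(s₁, s₂)`. -/
abbrev TwoParticle := PiLp 2 (fun _ : Spin × Spin => L2R6)

theorem memLp_tensor (u v : L2R3) :
    MemLp (fun q : R6 => u q.fst * v q.snd) 2 (volume : Measure R6) := by
  have hu := (memLp_two_iff_integrable_sq_norm (Lp.aestronglyMeasurable u)).1 (Lp.memLp u)
  have hv := (memLp_two_iff_integrable_sq_norm (Lp.aestronglyMeasurable v)).1 (Lp.memLp v)
  have hm : AEStronglyMeasurable (fun p : R3 × R3 => u p.1 * v p.2)
      ((volume : Measure R3).prod volume) :=
    (Lp.aestronglyMeasurable u).comp_fst.mul (Lp.aestronglyMeasurable v).comp_snd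
  have h : MemLp (fun p : R3 × R3 => u p.1 * v p.2) 2 ((volume : Measure R3).prod volume) := by
    rw [memLp_two_iff_integrable_sq_norm hm]
    simpa [mul_pow] using hu.mul_prod hv
  exact h.comp_measurePreserving (WithLp.volume_preserving_ofLp (U := R3) (V := R3))

/-- The elementary tensor `u ⊗ v`, `(x₁, x₂) ↦ u(x₁) v(x₂)`. -/
def tensorFun (u v : L2R3) : L2R6 := (memLp_tensor u v).toLp

/-- The elementary tensor of two single-particle vectors. -/
def tensorVec (u v : OneParticle) : TwoParticle :=
  WithLp.toLp 2 (fun s => tensorFun (u s.1) (v s.2))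

/-- The operator `A ⊙ B` on the span of the elementary tensors `u ⊗ v`, `u ∈ dom A`, `v ∈ dom B`:
`(A ⊙ B)(u ⊗ v) = A u ⊗ B v`. -/
def algTensorOp (A B : OneParticle →ₗ.[ℂ] OneParticle) : TwoParticle →ₗ.[ℂ] TwoParticle :=
  (Submodule.span ℂ
    {p | ∃ (u : A.domain) (v : B.domain),
      p = (tensorVec u.1 v.1, tensorVec (A u) (B v))}).toLinearPMap

/-- The operator `A ⊗ B`, the closure of `A ⊙ B`. -/
def tensorOp (A B : OneParticle →ₗ.[ℂ] OneParticle) : TwoParticle →ₗ.[ℂ] TwoParticle :=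
  (algTensorOp A B).closure

/-- The identity operator on the single-particle space. -/
def oneOp : OneParticle →ₗ.[ℂ] OneParticle :=
  (LinearMap.id : OneParticle →ₗ[ℂ] OneParticle).toPMap ⊤

/-- The two-particle operator `H = h ⊗ 1 + 1 ⊗ h` (operator sum). -/
def twoParticleOp (α β : ℝ) : TwoParticle →ₗ.[ℂ] TwoParticle :=
  tensorOp (rashba α β) oneOp + tensorOp oneOp (rashba α β)

/-- The bounded operator `R` is the resolvent `(T - z)⁻¹` of the operator `T` at `z`. -/
def IsResolventAt {E : Type*} [NormedAddCommGroup E] [NormedSpace ℂ E]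
    (T : E →ₗ.[ℂ] E) (z : ℂ) (R : E →L[ℂ] E) : Prop :=
  (∀ f : E, ∃ u : T.domain, (u : E) = R f ∧ T u - z • (u : E) = f) ∧
    ∀ u : T.domain, R (T u - z • (u : E)) = u

/-! ### The coupled-spin basis and the centre-of-mass coordinates -/

/-- The labels `σ = (S, s)`, `S ∈ {0, 1}`, `s ∈ {-S, …, S}`, of the basis `|S s⟩` of
`ℂ³ ⊕ ℂ¹`. -/
inductive Coupled
  | singlet
  | tripletMinus
  | tripletZero
  | tripletPlus
  deriving DecidableEq

instance : Fintype Coupled where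
  elems := {.singlet, .tripletMinus, .tripletZero, .tripletPlus}
  complete := by intro σ; cases σ <;> decide

/-- The total spin `S` of `σ = (S, s)`. -/
def Coupled.S : Coupled → ℕ
  | .singlet => 0
  | .tripletMinus => 1
  | .tripletZero => 1
  | .tripletPlus => 1

/-- The projection `s` of `σ = (S, s)`. -/
def Coupled.s : Coupled → ℤ
  | .singlet => 0
  | .tripletMinus => -1
  | .tripletZero => 0
  | .tripletPlus => 1

/-- The Clebsch-Gordan coefficients `⟨1/2 s₁, 1/2 s₂ | S s⟩` of `SU(2)`. -/
def clebschGordan (s₁ s₂ : Spin) : Coupled → ℂ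
  | .singlet =>
      if s₁ = 0 ∧ s₂ = 1 then ((1 / √2 : ℝ) : ℂ)
      else if s₁ = 1 ∧ s₂ = 0 then ((-(1 / √2) : ℝ) : ℂ) else 0
  | .tripletMinus => if s₁ = 1 ∧ s₂ = 1 then 1 else 0
  | .tripletZero => if s₁ ≠ s₂ then ((1 / √2 : ℝ) : ℂ) else 0
  | .tripletPlus => if s₁ = 0 ∧ s₂ = 0 then 1 else 0

/-- The coordinate transformation `K q = Q`, `q = (x₁, x₂)`, `Q = (x, X)` with
`x = x₁ - x₂`, `X = (x₁ + x₂) / 2`. -/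
def comMap (q : R6) : R6 :=
  WithLp.toLp 2 (q.fst - q.snd, (1 / 2 : ℝ) • (q.fst + q.snd))

theorem measurePreserving_comMap : MeasurePreserving comMap (volume : Measure R6) volume := by
  have h1 : MeasurePreserving (fun p : R3 × R3 => (p.1, p.2 + (1 / 2 : ℝ) • p.1))
      (volume.prod volume) (volume.prod volume) :=
    (MeasurePreserving.id (volume : Measure R3)).skew_product
      (g := fun x y => y + (1 / 2 : ℝ) • x) (by fun_prop)
      (Eventually.of_forall fun x => (measurePreserving_add_right volume _).map_eq)
  have h2 : MeasurePreserving (fun p : R3 × R3 => (p.1 - p.2, p.2))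
      (volume.prod volume) (volume.prod volume) := by
    have := ((Measure.measurePreserving_swap (μ := (volume : Measure R3))
      (ν := (volume : Measure R3))).comp
      ((MeasurePreserving.id (volume : Measure R3)).skew_product
        (g := fun y x => x - y) (by fun_prop)
        (Eventually.of_forall fun x => (measurePreserving_sub_right volume x).map_eq))).comp
      (Measure.measurePreserving_swap (μ := (volume : Measure R3)) (ν := (volume : Measure R3)))
    exact this
  have h := (WithLp.volume_preserving_toLp (U := R3) (V := R3)).comp
    ((h1.comp h2).comp (WithLp.volume_preserving_ofLp (U := R3) (V := R3)))
  have hK : comMap = WithLp.toLp 2 ∘ ((fun p : R3 × R3 => (p.1, p.2 + (1 / 2 : ℝ) • p.1)) ∘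
      fun p : R3 × R3 => (p.1 - p.2, p.2)) ∘ WithLp.ofLp := by
    funext q
    have : (1 / 2 : ℝ) • (q.fst + q.snd) = q.snd + (1 / 2 : ℝ) • (q.fst - q.snd) := by module
    simp only [comMap, this]
    rfl
  rw [hK]
  exact h

/-- The unitary transformation `(𝒰 f)(q) = f (K q)` of `L²(ℝ⁶)`. -/
def comUnitary : L2R6 →L[ℂ] L2R6 :=
  (Lp.compMeasurePreservingₗᵢ ℂ comMap measurePreserving_comMap).toContinuousLinearMap

/-- The Hilbert space `L²(ℝ⁶) ⊗ (ℂ³ ⊕ ℂ¹)` in components with respect to the basis `|S s⟩`. -/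
abbrev CoupledSpace := PiLp 2 (fun _ : Coupled => L2R6)

/-- The unitary map `L` from the two-particle space to `L²(ℝ⁶) ⊗ (ℂ³ ⊕ ℂ¹)`:
`(u ⊗ |s₁⟩) ⊗ (v ⊗ |s₂⟩) ↦ ∑_{S,s} ⟨1/2 s₁, 1/2 s₂ | S s⟩ 𝒰(u ⊗ v) ⊗ |S s⟩`. -/
def comCoupledMap : TwoParticle →L[ℂ] CoupledSpace :=
  ((PiLp.continuousLinearEquiv 2 ℂ (fun _ : Coupled => L2R6)).symm :
      (Coupled → L2R6) →L[ℂ] CoupledSpace) ∘L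
    ContinuousLinearMap.pi (fun σ => ∑ s₁, ∑ s₂, clebschGordan s₁ s₂ σ •
      (comUnitary ∘L PiLp.proj 2 (fun _ : Spin × Spin => L2R6) (s₁, s₂)))

/-- `R^c = L R L*`. -/
def comConj (R : TwoParticle →L[ℂ] TwoParticle) : CoupledSpace →L[ℂ] CoupledSpace :=
  comCoupledMap ∘L R ∘L ContinuousLinearMap.adjoint comCoupledMap

/-- The vector `f ⊗ |σ⟩`. -/
def tensorKet (f : L2R6) (σ : Coupled) : CoupledSpace :=
  WithLp.toLp 2 (Pi.single σ f)

/-! ### The Green function -/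

/-- `g = LIM ∫ k(· - Q') f(Q') dQ'`: the integrals over the balls `|Q'| ≤ r` converge to `g` in
`L²(ℝ⁶)` as `r → ∞`. -/
def IsLimConv (k : R6 → ℂ) (f g : L2R6) : Prop :=
  (∀ r : ℝ, ∀ᵐ Q : R6, IntegrableOn (fun Q' : R6 => k (Q - Q') * f Q')
    (Metric.closedBall 0 r)) ∧
  Tendsto (fun r : ℝ => eLpNorm
    (fun Q : R6 => (∫ Q' in Metric.closedBall (0 : R6) r, k (Q - Q') * f Q') - g Q) 2 volume)
    atTop (𝓝 0)

/-- `G = (G σ' σ)` is the Green function of the two-particle operator in the centre-of-mass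
coordinates and the coupled-spin basis: the resolvent `R(z) = (H - z)⁻¹` exists as a bounded
operator, and `R^c(z) = L R(z) L*` acts by
`R^c(z) (f(Q) ⊗ |σ⟩) = ∑_{σ'} LIM ∫ G_{σ'σ}(Q - Q') f(Q') dQ' ⊗ |σ'⟩`, `Q = K q`. -/
def IsGreenFunction (α β : ℝ) (z : ℂ) (G : Coupled → Coupled → R6 → ℂ) : Prop :=
  (∀ σ' σ, LocallyIntegrable (G σ' σ) (volume : Measure R6)) ∧
  ∃ R : TwoParticle →L[ℂ] TwoParticle, IsResolventAt (twoParticleOp α β) z R ∧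
    ∀ (f : L2R6) (σ : Coupled), ∃ g : Coupled → L2R6,
      (∀ σ', IsLimConv (G σ' σ) f (g σ')) ∧
      comConj R (tensorKet (comUnitary f) σ) = ∑ σ', tensorKet (comUnitary (g σ')) σ'

/-- The Macdonald function `K_ν(w) = ∫_0^∞ exp(-w cosh t) cosh(ν t) dt` for `Re w > 0`. -/
def macdonald (ν w : ℂ) : ℂ :=
  ∫ t in Set.Ioi (0 : ℝ), Complex.exp (-w * Complex.cosh t) * Complex.cosh (ν * t)

/-- The principal branch of the complex square root. -/
def csqrt (w : ℂ) : ℂ := w ^ (1 / 2 : ℂ)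

/-- The Kronecker symbol. -/
def kron {ι : Type*} [DecidableEq ι] (i j : ι) : ℂ := if i = j then 1 else 0

end

end Rashba

open Rashba MeasureTheory

namespace Rashba

noncomputable section

open MeasureTheory Filter Topology Complex FourierTransform
open scoped ENNReal SchwartzMap LineDeriv Laplacian ContDiff InnerProductSpace Convolution

/-! ### Fourier multipliers on `L²` -/

section FourierMultiplier

variable {E : Type*} [NormedAddCommGroup E] [InnerProductSpace ℝ E] [FiniteDimensional ℝ E]
  [MeasurableSpace E] [BorelSpace E]

/-- Multiplication by an essentially bounded function on `L²`. -/
def mulLp {m : E → ℂ} (hm : MemLp m ⊤ (volume : Measure E)) :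
    Lp ℂ 2 (volume : Measure E) →L[ℂ] Lp ℂ 2 (volume : Measure E) :=
  LinearMap.mkContinuous
    { toFun := fun f => (hm.toLp m • f : Lp ℂ 2 (volume : Measure E))
      map_add' := fun f g => Lp.add_smul _ f g
      map_smul' := fun c f => (Lp.smul_comm c (hm.toLp m) f).symm } ‖hm.toLp m‖
    fun f => Lp.norm_smul_le _ f

theorem coeFn_mulLp {m : E → ℂ} (hm : MemLp m ⊤ (volume : Measure E))
    (f : Lp ℂ 2 (volume : Measure E)) : mulLp hm f =ᵐ[volume] fun x => m x * f x := by
  have h := Lp.coeFn_lpSMul (r := 2) (hm.toLp m) f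
  filter_upwards [h, hm.coeFn_toLp] with x h1 h2
  change (hm.toLp m • f : Lp ℂ 2 (volume : Measure E)) x = _
  rw [h1, Pi.smul_apply', h2, smul_eq_mul]

variable (E) in
/-- The Fourier transform of `L²`. -/
abbrev fourierL2 : Lp ℂ 2 (volume : Measure E) ≃ₗᵢ[ℂ] Lp ℂ 2 (volume : Measure E) :=
  Lp.fourierTransformₗᵢ E ℂ

/-- The Fourier multiplier with an essentially bounded symbol. -/
def fourierMul {m : E → ℂ} (hm : MemLp m ⊤ (volume : Measure E)) :
    Lp ℂ 2 (volume : Measure E) →L[ℂ] Lp ℂ 2 (volume : Measure E) :=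
  ((fourierL2 E).symm : Lp ℂ 2 (volume : Measure E) →L[ℂ] _) ∘L mulLp hm ∘L
    (fourierL2 E : Lp ℂ 2 (volume : Measure E) →L[ℂ] _)

theorem fourier_fourierMul {m : E → ℂ} (hm : MemLp m ⊤ (volume : Measure E))
    (f : Lp ℂ 2 (volume : Measure E)) :
    fourierL2 E (fourierMul hm f) =ᵐ[volume] fun ξ => m ξ * fourierL2 E f ξ := by
  have h : fourierL2 E (fourierMul hm f) = mulLp hm (fourierL2 E f) :=
    (fourierL2 E).apply_symm_apply _
  rw [h]
  exact coeFn_mulLp hm _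

theorem fourierL2_injective {f g : Lp ℂ 2 (volume : Measure E)}
    (h : fourierL2 E f =ᵐ[volume] fourierL2 E g) : f = g :=
  (fourierL2 E).injective (Lp.ext h)

theorem eq_fourierMul {m : E → ℂ} (hm : MemLp m ⊤ (volume : Measure E))
    {f g : Lp ℂ 2 (volume : Measure E)}
    (h : fourierL2 E g =ᵐ[volume] fun ξ => m ξ * fourierL2 E f ξ) :
    g = fourierMul hm f :=
  fourierL2_injective (h.trans (fourier_fourierMul hm f).symm)

theorem coeFn_fourierL2_add (f g : Lp ℂ 2 (volume : Measure E)) :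
    fourierL2 E (f + g) =ᵐ[volume] fun ξ => fourierL2 E f ξ + fourierL2 E g ξ := by
  rw [map_add]
  exact Lp.coeFn_add _ _

theorem coeFn_fourierL2_sub (f g : Lp ℂ 2 (volume : Measure E)) :
    fourierL2 E (f - g) =ᵐ[volume] fun ξ => fourierL2 E f ξ - fourierL2 E g ξ := by
  rw [map_sub]
  exact Lp.coeFn_sub _ _

theorem coeFn_fourierL2_smul (c : ℂ) (f : Lp ℂ 2 (volume : Measure E)) :
    fourierL2 E (c • f) =ᵐ[volume] fun ξ => c * fourierL2 E f ξ := by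
  rw [LinearIsometryEquiv.map_smul]
  exact Lp.coeFn_smul _ _

theorem fourierMul_comp {m n k : E → ℂ} (hm : MemLp m ⊤ (volume : Measure E))
    (hn : MemLp n ⊤ (volume : Measure E)) (hk : MemLp k ⊤ (volume : Measure E))
    (h : ∀ ξ, m ξ * n ξ = k ξ) (f : Lp ℂ 2 (volume : Measure E)) :
    fourierMul hm (fourierMul hn f) = fourierMul hk f := by
  refine eq_fourierMul hk ?_
  filter_upwards [fourier_fourierMul hm (fourierMul hn f), fourier_fourierMul hn f] with ξ h1 h2
  rw [h1, h2, ← mul_assoc, h]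

theorem fourierMul_comm {m n : E → ℂ} (hm : MemLp m ⊤ (volume : Measure E))
    (hn : MemLp n ⊤ (volume : Measure E)) (f : Lp ℂ 2 (volume : Measure E)) :
    fourierMul hm (fourierMul hn f) = fourierMul hn (fourierMul hm f) := by
  refine eq_fourierMul hn ?_
  filter_upwards [fourier_fourierMul hm (fourierMul hn f), fourier_fourierMul hn f,
    fourier_fourierMul hm f] with ξ h1 h2 h3
  rw [h1, h2, h3]
  ring

theorem fourierMul_injective {m : E → ℂ} (hm : MemLp m ⊤ (volume : Measure E))
    (h0 : ∀ ξ, m ξ ≠ 0) : Function.Injective (fourierMul hm) := by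
  rw [injective_iff_map_eq_zero]
  intro f hf
  refine fourierL2_injective ?_
  have h := fourier_fourierMul hm f
  rw [hf, map_zero] at h
  rw [map_zero]
  filter_upwards [h, Lp.coeFn_zero ℂ 2 (volume : Measure E)] with ξ h1 h2
  rw [h2] at h1 ⊢
  simpa [h0 ξ] using h1.symm

theorem memLp_top_of_norm_le {m : E → ℂ} (hm : Measurable m) (C : ℝ) (h : ∀ ξ, ‖m ξ‖ ≤ C) :
    MemLp m ⊤ (volume : Measure E) :=
  memLp_top_of_bound hm.aestronglyMeasurable C (Eventually.of_forall h)

/-- In `L²`, multiplication of a distribution by a function of temperate growth is pointwise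
multiplication. -/
theorem smulLeftCLM_eq_iff {g : E → ℂ} (hg : g.HasTemperateGrowth)
    (f h : Lp ℂ 2 (volume : Measure E)) :
    TemperedDistribution.smulLeftCLM ℂ g (f : 𝓢'(E, ℂ)) = (h : 𝓢'(E, ℂ)) ↔
      h =ᵐ[volume] fun x => g x * f x := by
  have hgc : Continuous g := hg.1.continuous
  constructor
  · intro H
    have hf : LocallyIntegrable f (volume : Measure E) :=
      (Lp.memLp f).locallyIntegrable one_le_two
    have hh : LocallyIntegrable h (volume : Measure E) :=
      (Lp.memLp h).locallyIntegrable one_le_two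
    have hgf : LocallyIntegrable (fun x => g x * f x) (volume : Measure E) := by
      have := (locallyIntegrableOn_univ.2 hf).continuousOn_mul (hgc.continuousOn (s := Set.univ))
        isOpen_univ.isLocallyClosed
      exact locallyIntegrableOn_univ.1 this
    refine ae_eq_of_integral_contDiff_smul_eq hh hgf fun φ hφ hφc => ?_
    have hg₁ : HasCompactSupport (Complex.ofRealCLM ∘ φ) := hφc.comp_left rfl
    have hg₂ : ContDiff ℝ ∞ (Complex.ofRealCLM ∘ φ) := by fun_prop
    have := congrArg (fun T => T (hg₁.toSchwartzMap hg₂)) H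
    simp only [TemperedDistribution.smulLeftCLM_apply_apply, Lp.toTemperedDistribution_apply,
      SchwartzMap.smulLeftCLM_apply_apply hg] at this
    simp at this
    rw [show (∫ x, φ x • h x) = ∫ x, (φ x : ℂ) * h x by simp, ← this]
    congr 1
    ext x
    simp
    ring
  · intro H
    ext u
    simp only [TemperedDistribution.smulLeftCLM_apply_apply, Lp.toTemperedDistribution_apply,
      SchwartzMap.smulLeftCLM_apply_apply hg]
    refine integral_congr_ae ?_
    filter_upwards [H] with x hx
    rw [hx]
    simp
    ring

/-- For functions in `L¹ ∩ L²` the `L²` Fourier transform is the Fourier integral. -/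
theorem coeFn_fourier_toLp {f : E → ℂ} (h1 : Integrable f) (h2 : MemLp f 2) :
    fourierL2 E (h2.toLp f) =ᵐ[volume] 𝓕 f := by
  have hh : LocallyIntegrable (fourierL2 E (h2.toLp f)) volume :=
      (Lp.memLp _).locallyIntegrable one_le_two
  have hc : Continuous (𝓕 f) := by
    exact VectorFourier.fourierIntegral_continuous Real.continuous_fourierChar
      continuous_inner h1
  refine ae_eq_of_integral_contDiff_smul_eq hh hc.locallyIntegrable fun φ hφ hφc => ?_
  have hg₁ : HasCompactSupport (Complex.ofRealCLM ∘ φ) := hφc.comp_left rfl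
  have hg₂ : ContDiff ℝ ∞ (Complex.ofRealCLM ∘ φ) := by fun_prop
  have H := congrArg (fun T => T (hg₁.toSchwartzMap hg₂))
    (Lp.fourier_toTemperedDistribution_eq (h2.toLp f))
  simp only [TemperedDistribution.fourier_apply, Lp.toTemperedDistribution_apply] at H
  have e1 : ∫ x, φ x • (fourierL2 E (h2.toLp f)) x =
      ∫ x, (hg₁.toSchwartzMap hg₂) x • (fourierL2 E (h2.toLp f)) x := by
    simp
  have e2 : ∫ x, φ x • 𝓕 f x = ∫ x, (hg₁.toSchwartzMap hg₂) x • 𝓕 f x := by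
    simp
  rw [e1, e2]
  refine H.symm.trans ?_
  have e3 := VectorFourier.integral_fourierIntegral_smul_eq_flip (L := innerₗ E)
    (μ := (volume : Measure E)) (ν := volume)
    Real.continuous_fourierChar continuous_inner (hg₁.toSchwartzMap hg₂).integrable h1
  rw [flip_innerₗ] at e3
  refine Eq.trans ?_ e3
  refine integral_congr_ae ?_
  filter_upwards [h2.coeFn_toLp] with x hx
  rw [hx, SchwartzMap.fourier_coe]
  rfl

end FourierMultiplier

/-! ### The one-particle operator without spin-orbit coupling -/

/-- The operator acting by `T i` on the component `i`. -/
def diagOp {ι H : Type*} [Fintype ι] [NormedAddCommGroup H] [NormedSpace ℂ H]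
    (T : ι → H →L[ℂ] H) : PiLp 2 (fun _ : ι => H) →L[ℂ] PiLp 2 (fun _ : ι => H) :=
  ((PiLp.continuousLinearEquiv 2 ℂ (fun _ : ι => H)).symm :
      (ι → H) →L[ℂ] PiLp 2 (fun _ : ι => H)) ∘L
    ContinuousLinearMap.pi (fun i => T i ∘L PiLp.proj 2 (fun _ : ι => H) i)

@[simp]
theorem diagOp_apply {ι H : Type*} [Fintype ι] [NormedAddCommGroup H] [NormedSpace ℂ H]
    (T : ι → H →L[ℂ] H) (f : PiLp 2 (fun _ : ι => H)) (i : ι) : diagOp T f i = T i (f i) := rfl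

/-- The sign of the spin projection. -/
def spinSign (s : Spin) : ℝ := if s = 0 then 1 else -1

/-- The symbol of the component `s` of the one-particle operator. -/
def symb (β : ℝ) (s : Spin) (ξ : R3) : ℝ := (2 * Real.pi) ^ 2 * ‖ξ‖ ^ 2 + β * spinSign s

theorem hasTemperateGrowth_symb (β : ℝ) (s : Spin) :
    (fun ξ => (symb β s ξ : ℂ)).HasTemperateGrowth := by
  unfold symb
  fun_prop

theorem rashbaExpr_no_coupling (β : ℝ) (u : OneParticle) (s : Spin) :
    rashbaExpr 0 β u s = - Δ (toDistr (u s)) + ((β * spinSign s : ℝ) : ℂ) • toDistr (u s) := by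
  have h : ∀ s s', 2 * spinOp 2 s s' = if s' = s then (spinSign s : ℂ) else 0 := by
    intro s s'
    fin_cases s <;> fin_cases s' <;> simp [spinOp, pauli, spinSign]
  fin_cases s <;>
  · simp only [rashbaExpr, h, Fin.sum_univ_two, ofReal_zero, ofReal_mul, Fin.zero_eta, Fin.mk_one,
      if_true, one_ne_zero, zero_ne_one, if_false]
    module

theorem fourier_rashbaExpr (β : ℝ) (u : OneParticle) (s : Spin) :
    𝓕 (rashbaExpr 0 β u s) =
      TemperedDistribution.smulLeftCLM ℂ (fun ξ => (symb β s ξ : ℂ)) (𝓕 (toDistr (u s))) := by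
  rw [rashbaExpr_no_coupling, TemperedDistribution.laplacian_eq_fourierMultiplierCLM,
    TemperedDistribution.fourierMultiplierCLM_apply]
  have h1 : (fun ξ : R3 => (symb β s ξ : ℂ)) =
      ((((2 * Real.pi) ^ 2 : ℝ) : ℂ) • fun ξ : R3 => ((‖ξ‖ ^ 2 : ℝ) : ℂ)) +
        fun _ => ((β * spinSign s : ℝ) : ℂ) := by
    ext ξ
    simp [symb]
  rw [h1, TemperedDistribution.smulLeftCLM_add (by fun_prop) (by fun_prop),
    TemperedDistribution.smulLeftCLM_smul (by fun_prop)]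
  rw [FourierTransform.fourier_add, FourierTransform.fourier_smul, neg_smul, neg_neg,
    ← Complex.coe_smul, FourierTransform.fourier_smul, FourierTransform.fourier_fourierInv_eq]
  simp

theorem mem_rashbaGraph_iff (β : ℝ) (u w : OneParticle) :
    (u, w) ∈ rashbaGraph 0 β ↔
      ∀ s, fourierL2 R3 (w s) =ᵐ[volume] fun ξ => symb β s ξ * fourierL2 R3 (u s) ξ := by
  have key : ∀ s, toDistr (w s) = rashbaExpr 0 β u s ↔
      fourierL2 R3 (w s) =ᵐ[volume] fun ξ => symb β s ξ * fourierL2 R3 (u s) ξ := by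
    intro s
    rw [← smulLeftCLM_eq_iff (hasTemperateGrowth_symb β s)]
    have hw : 𝓕 (toDistr (w s)) = ((fourierL2 R3 (w s) : Lp ℂ 2 volume) : 𝓢'(R3, ℂ)) :=
      Lp.fourier_toTemperedDistribution_eq (w s)
    have hu : 𝓕 (toDistr (u s)) = ((fourierL2 R3 (u s) : Lp ℂ 2 volume) : 𝓢'(R3, ℂ)) :=
      Lp.fourier_toTemperedDistribution_eq (u s)
    rw [← hw, ← hu, ← fourier_rashbaExpr]
    constructor
    · intro h
      rw [h]
    · intro h
      have := congrArg (fun T : 𝓢'(R3, ℂ) => 𝓕⁻ T) h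
      simpa using this.symm
  constructor
  · rintro ⟨-, h⟩ s
    exact (key s).1 (h s)
  · intro h
    refine ⟨fun s => ?_, fun s => (key s).2 (h s)⟩
    rw [TemperedDistribution.memSobolev_iff_exists_smulLeftCLM_fourier]
    have hu : 𝓕 (toDistr (u s)) = ((fourierL2 R3 (u s) : Lp ℂ 2 volume) : 𝓢'(R3, ℂ)) :=
      Lp.fourier_toTemperedDistribution_eq (u s)
    refine ⟨fourierL2 R3 (u s) + (((2 * Real.pi) ^ 2)⁻¹ : ℂ) •
      (fourierL2 R3 (w s) - ((β * spinSign s : ℝ) : ℂ) • fourierL2 R3 (u s)), ?_⟩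
    change TemperedDistribution.smulLeftCLM _ _ (𝓕 (toDistr (u s))) = _
    rw [hu, smulLeftCLM_eq_iff (by fun_prop)]
    filter_upwards [h s, Lp.coeFn_add (fourierL2 R3 (u s)) ((((2 * Real.pi) ^ 2)⁻¹ : ℂ) •
      (fourierL2 R3 (w s) - ((β * spinSign s : ℝ) : ℂ) • fourierL2 R3 (u s))),
      Lp.coeFn_smul (((2 * Real.pi) ^ 2)⁻¹ : ℂ)
        (fourierL2 R3 (w s) - ((β * spinSign s : ℝ) : ℂ) • fourierL2 R3 (u s)),
      Lp.coeFn_sub (fourierL2 R3 (w s)) (((β * spinSign s : ℝ) : ℂ) • fourierL2 R3 (u s)),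
      Lp.coeFn_smul ((β * spinSign s : ℝ) : ℂ) (fourierL2 R3 (u s))] with ξ h1 h2 h3 h4 h5
    rw [h2, Pi.add_apply, h3, Pi.smul_apply, h4, Pi.sub_apply, h5, Pi.smul_apply, h1]
    have hpi : (Real.pi : ℂ) ≠ 0 := by exact_mod_cast Real.pi_ne_zero
    simp [symb]
    field_simp
    ring

/-- `r` is the resolvent of the operator `A` at `-i`, expressed through the graph of `A`. -/
def IsCayley {H : Type*} [NormedAddCommGroup H] [NormedSpace ℂ H] (A : H →ₗ.[ℂ] H)
    (r : H →L[ℂ] H) : Prop :=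
  ∀ u w : H, (u, w) ∈ A.graph ↔ ∃ f, u = r f ∧ w = f - I • r f

theorem norm_inv_ofReal_add_I_le (x : ℝ) : ‖((x : ℂ) + I)⁻¹‖ ≤ 1 := by
  rw [norm_inv]
  refine inv_le_one_of_one_le₀ ?_
  have := abs_im_le_norm ((x : ℂ) + I)
  simpa using this

theorem ofReal_add_I_ne_zero (x : ℝ) : (x : ℂ) + I ≠ 0 := by
  intro h
  have := congrArg Complex.im h
  simp at this

theorem continuous_symb (β : ℝ) (s : Spin) : Continuous (symb β s) := by
  unfold symb
  fun_prop

theorem memLp_top_inv_symb (β : ℝ) (s : Spin) :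
    MemLp (fun ξ : R3 => ((symb β s ξ : ℂ) + I)⁻¹) ⊤ (volume : Measure R3) := by
  have := continuous_symb β s
  exact memLp_top_of_norm_le (by fun_prop) 1 fun ξ => norm_inv_ofReal_add_I_le _

/-- The resolvent of the one-particle operator at `-i`. -/
def rashbaInv (β : ℝ) : OneParticle →L[ℂ] OneParticle :=
  diagOp fun s => fourierMul (memLp_top_inv_symb β s)

theorem isCayley_rashba (β : ℝ) : IsCayley (rashba 0 β) (rashbaInv β) := by
  intro u w
  have hg : (rashba 0 β).graph = rashbaGraph 0 β := by
    refine Submodule.toLinearPMap_graph_eq _ ?_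
    rintro ⟨x, y⟩ hx (rfl : x = 0)
    rw [mem_rashbaGraph_iff] at hx
    ext1 s
    refine fourierL2_injective ?_
    have h0 : fourierL2 R3 ((0 : OneParticle) s) = 0 := by
      rw [PiLp.zero_apply, map_zero]
    filter_upwards [hx s, Lp.coeFn_zero ℂ 2 (volume : Measure R3)] with ξ h1 h2
    rw [h1, h0, h2]
    simp
  rw [hg, mem_rashbaGraph_iff]
  constructor
  · intro h
    have hr : u = rashbaInv β (w + I • u) := by
      ext1 s
      refine eq_fourierMul (memLp_top_inv_symb β s) ?_
      filter_upwards [h s, coeFn_fourierL2_add (w s) (I • u s),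
        coeFn_fourierL2_smul I (u s)] with ξ h1 h2 h3
      change _ = _ * fourierL2 R3 (w s + I • u s) ξ
      rw [h2, h3, h1, ← add_mul,
        inv_mul_cancel_left₀ (ofReal_add_I_ne_zero _)]
    refine ⟨w + I • u, hr, ?_⟩
    rw [← hr, add_sub_cancel_right]
  · rintro ⟨f, rfl, rfl⟩ s
    filter_upwards [fourier_fourierMul (memLp_top_inv_symb β s) (f s),
      coeFn_fourierL2_sub (f s) (I • rashbaInv β f s),
      coeFn_fourierL2_smul I (rashbaInv β f s)] with ξ h1 h2 h3
    rw [PiLp.sub_apply, PiLp.smul_apply, h2, h3]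
    change _ - I * fourierL2 R3 (fourierMul (memLp_top_inv_symb β s) (f s)) ξ =
      _ * fourierL2 R3 (fourierMul (memLp_top_inv_symb β s) (f s)) ξ
    rw [h1]
    have := ofReal_add_I_ne_zero (symb β s ξ)
    field_simp
    ring

/-! ### Tensor products of `L²` functions -/

theorem norm_sq_Lp_two {α : Type*} [MeasurableSpace α] {μ : Measure α} (f : Lp ℂ 2 μ) :
    ‖f‖ ^ 2 = ∫ x, ‖f x‖ ^ 2 ∂μ := by
  have h := L2.inner_def (𝕜 := ℂ) f f
  rw [inner_self_eq_norm_sq_to_K] at h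
  simp only [inner_self_eq_norm_sq_to_K] at h
  have h2 : ((‖f‖ ^ 2 : ℝ) : ℂ) = ((∫ x, ‖f x‖ ^ 2 ∂μ : ℝ) : ℂ) := by
    rw [← integral_complex_ofReal]
    simpa using h
  exact_mod_cast h2

theorem quasiMeasurePreserving_fst_R6 :
    Measure.QuasiMeasurePreserving (fun q : R6 => q.fst) volume volume :=
  (Measure.quasiMeasurePreserving_fst (μ := (volume : Measure R3))
    (ν := (volume : Measure R3))).comp
      (WithLp.volume_preserving_ofLp (U := R3) (V := R3)).quasiMeasurePreserving

theorem quasiMeasurePreserving_snd_R6 :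
    Measure.QuasiMeasurePreserving (fun q : R6 => q.snd) volume volume :=
  (Measure.quasiMeasurePreserving_snd (μ := (volume : Measure R3))
    (ν := (volume : Measure R3))).comp
      (WithLp.volume_preserving_ofLp (U := R3) (V := R3)).quasiMeasurePreserving

theorem integral_R6 {F : Type*} [NormedAddCommGroup F] [NormedSpace ℝ F] (f : R6 → F) :
    ∫ q, f q = ∫ p : R3 × R3, f (WithLp.toLp 2 p) :=
  ((WithLp.volume_preserving_toLp (U := R3) (V := R3)).integral_comp
    (MeasurableEquiv.toLp 2 (R3 × R3)).measurableEmbedding f).symm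

theorem coeFn_tensorFun (u v : L2R3) :
    tensorFun u v =ᵐ[volume] fun q : R6 => u q.fst * v q.snd :=
  (memLp_tensor u v).coeFn_toLp

theorem norm_tensorFun (u v : L2R3) : ‖tensorFun u v‖ = ‖u‖ * ‖v‖ := by
  have h : ‖tensorFun u v‖ ^ 2 = (‖u‖ * ‖v‖) ^ 2 := by
    rw [mul_pow, norm_sq_Lp_two, norm_sq_Lp_two, norm_sq_Lp_two]
    have h1 : ∫ q, ‖tensorFun u v q‖ ^ 2 = ∫ q : R6, ‖u q.fst‖ ^ 2 * ‖v q.snd‖ ^ 2 := by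
      refine integral_congr_ae ?_
      filter_upwards [coeFn_tensorFun u v] with q hq
      rw [hq, norm_mul, mul_pow]
    rw [h1, integral_R6]
    exact integral_prod_mul (fun x : R3 => ‖u x‖ ^ 2) fun x : R3 => ‖v x‖ ^ 2
  exact (sq_eq_sq₀ (norm_nonneg _) (by positivity)).1 h

theorem tensorFun_add_left (a b v : L2R3) :
    tensorFun (a + b) v = tensorFun a v + tensorFun b v := by
  refine Lp.ext ?_
  filter_upwards [coeFn_tensorFun (a + b) v, Lp.coeFn_add (tensorFun a v) (tensorFun b v),
    coeFn_tensorFun a v, coeFn_tensorFun b v,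
    quasiMeasurePreserving_fst_R6.ae (Lp.coeFn_add a b)] with q h1 h2 h3 h4 h5
  rw [h1, h2, Pi.add_apply, h3, h4, h5, Pi.add_apply, add_mul]

theorem tensorFun_smul_left (c : ℂ) (a v : L2R3) :
    tensorFun (c • a) v = c • tensorFun a v := by
  refine Lp.ext ?_
  filter_upwards [coeFn_tensorFun (c • a) v, Lp.coeFn_smul c (tensorFun a v),
    coeFn_tensorFun a v,
    quasiMeasurePreserving_fst_R6.ae (Lp.coeFn_smul c a)] with q h1 h2 h3 h5
  rw [h1, h2, Pi.smul_apply, h3, h5, Pi.smul_apply, smul_mul_assoc]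

theorem tensorFun_add_right (v a b : L2R3) :
    tensorFun v (a + b) = tensorFun v a + tensorFun v b := by
  refine Lp.ext ?_
  filter_upwards [coeFn_tensorFun v (a + b), Lp.coeFn_add (tensorFun v a) (tensorFun v b),
    coeFn_tensorFun v a, coeFn_tensorFun v b,
    quasiMeasurePreserving_snd_R6.ae (Lp.coeFn_add a b)] with q h1 h2 h3 h4 h5
  rw [h1, h2, Pi.add_apply, h3, h4, h5, Pi.add_apply, mul_add]

theorem tensorFun_smul_right (c : ℂ) (v a : L2R3) :
    tensorFun v (c • a) = c • tensorFun v a := by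
  refine Lp.ext ?_
  filter_upwards [coeFn_tensorFun v (c • a), Lp.coeFn_smul c (tensorFun v a),
    coeFn_tensorFun v a,
    quasiMeasurePreserving_snd_R6.ae (Lp.coeFn_smul c a)] with q h1 h2 h3 h5
  rw [h1, h2, Pi.smul_apply, h3, h5, Pi.smul_apply, mul_smul_comm]

/-- The tensor product as a bilinear map. -/
def tensorBilin : L2R3 →ₗ[ℂ] L2R3 →ₗ[ℂ] L2R6 :=
  LinearMap.mk₂ ℂ tensorFun tensorFun_add_left tensorFun_smul_left tensorFun_add_right
    tensorFun_smul_right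

theorem norm_tensorBilin_le (u v : L2R3) : ‖tensorBilin u v‖ ≤ 1 * ‖u‖ * ‖v‖ := by
  rw [one_mul]
  exact (norm_tensorFun u v).le

theorem continuous_tensorFun : Continuous fun p : L2R3 × L2R3 => tensorFun p.1 p.2 :=
  (LinearMap.mkContinuous₂ tensorBilin 1 norm_tensorBilin_le).continuous₂

theorem fourier_tensor (f g : R3 → ℂ) (ξ : R6) :
    𝓕 (fun q : R6 => f q.fst * g q.snd) ξ = 𝓕 f ξ.fst * 𝓕 g ξ.snd := by
  rw [Real.fourier_eq, Real.fourier_eq, Real.fourier_eq, integral_R6]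
  refine Eq.trans ?_ (integral_prod_mul
    (fun x : R3 => Real.fourierChar (-⟪x, ξ.fst⟫_ℝ) • f x)
    fun x : R3 => Real.fourierChar (-⟪x, ξ.snd⟫_ℝ) • g x)
  congr 1
  ext p
  rw [WithLp.prod_inner_apply, neg_add, AddChar.map_add_eq_mul]
  simp only [Circle.smul_def, smul_eq_mul, Circle.coe_mul, WithLp.toLp_fst, WithLp.toLp_snd,
    WithLp.ofLp_fst, WithLp.ofLp_snd]
  ring

theorem coeFn_fourierL2_of_integrable {E : Type*} [NormedAddCommGroup E] [InnerProductSpace ℝ E]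
    [FiniteDimensional ℝ E] [MeasurableSpace E] [BorelSpace E] {u : Lp ℂ 2 (volume : Measure E)}
    (hu : Integrable u volume) : fourierL2 E u =ᵐ[volume] 𝓕 (u : E → ℂ) := by
  have h := coeFn_fourier_toLp hu (Lp.memLp u)
  rwa [Lp.toLp_coeFn] at h

theorem fourierL2_tensorFun_of_integrable {u v : L2R3} (hu : Integrable u volume)
    (hv : Integrable v volume) :
    fourierL2 R6 (tensorFun u v) = tensorFun (fourierL2 R3 u) (fourierL2 R3 v) := by
  have hI' : Integrable (fun p : R3 × R3 => u p.1 * v p.2) volume := hu.mul_prod hv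
  have hI : Integrable (fun q : R6 => u q.fst * v q.snd) :=
    (WithLp.volume_preserving_ofLp (U := R3) (V := R3)).integrable_comp_of_integrable hI'
  have e4 := coeFn_fourier_toLp hI (memLp_tensor u v)
  refine Lp.ext (e4.trans ?_)
  filter_upwards [coeFn_tensorFun (fourierL2 R3 u) (fourierL2 R3 v),
    quasiMeasurePreserving_fst_R6.ae (coeFn_fourierL2_of_integrable hu),
    quasiMeasurePreserving_snd_R6.ae (coeFn_fourierL2_of_integrable hv)] with ξ h2 h3 h4
  rw [h2, h3, h4, fourier_tensor]

theorem fourierL2_tensorFun (u v : L2R3) :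
    fourierL2 R6 (tensorFun u v) = tensorFun (fourierL2 R3 u) (fourierL2 R3 v) := by
  have hd : DenseRange (SchwartzMap.toLpCLM ℂ (E := R3) ℂ 2 volume) :=
    SchwartzMap.denseRange_toLpCLM (p := 2) ENNReal.ofNat_ne_top
  have hI : ∀ φ : 𝓢(R3, ℂ), Integrable (SchwartzMap.toLpCLM ℂ (E := R3) ℂ 2 volume φ) volume :=
    fun φ => φ.integrable.congr (φ.coeFn_toLp 2 volume).symm
  have hc := continuous_tensorFun
  refine hd.induction_on₂
    (p := fun u v : L2R3 => fourierL2 R6 (tensorFun u v) =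
      tensorFun (fourierL2 R3 u) (fourierL2 R3 v)) ?_
    (fun φ ψ => fourierL2_tensorFun_of_integrable (hI φ) (hI ψ)) u v
  exact isClosed_eq ((fourierL2 R6).continuous.comp hc)
    (hc.comp (((fourierL2 R3).continuous.comp continuous_fst).prodMk
      ((fourierL2 R3).continuous.comp continuous_snd)))

theorem fourierMul_fst_tensorFun {m : R3 → ℂ} (hm : MemLp m ⊤ volume)
    (hm' : MemLp (fun ξ : R6 => m ξ.fst) ⊤ volume) (u v : L2R3) :
    fourierMul hm' (tensorFun u v) = tensorFun (fourierMul hm u) v := by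
  refine (eq_fourierMul hm' ?_).symm
  rw [fourierL2_tensorFun, fourierL2_tensorFun]
  filter_upwards [coeFn_tensorFun (fourierL2 R3 (fourierMul hm u)) (fourierL2 R3 v),
    coeFn_tensorFun (fourierL2 R3 u) (fourierL2 R3 v),
    quasiMeasurePreserving_fst_R6.ae (fourier_fourierMul hm u)] with ξ h1 h2 h3
  rw [h1, h2, h3, mul_assoc]

theorem fourierMul_snd_tensorFun {m : R3 → ℂ} (hm : MemLp m ⊤ volume)
    (hm' : MemLp (fun ξ : R6 => m ξ.snd) ⊤ volume) (u v : L2R3) :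
    fourierMul hm' (tensorFun u v) = tensorFun u (fourierMul hm v) := by
  refine (eq_fourierMul hm' ?_).symm
  rw [fourierL2_tensorFun, fourierL2_tensorFun]
  filter_upwards [coeFn_tensorFun (fourierL2 R3 u) (fourierL2 R3 (fourierMul hm v)),
    coeFn_tensorFun (fourierL2 R3 u) (fourierL2 R3 v),
    quasiMeasurePreserving_snd_R6.ae (fourier_fourierMul hm v)] with ξ h1 h2 h3
  rw [h1, h2, h3]
  ring

/-- A function integrable on a product set is zero a.e. there if its integrals over all measurable
rectangles vanish. -/
theorem ae_eq_zero_of_forall_setIntegral_prod {α β : Type*} [MeasurableSpace α]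
    [MeasurableSpace β] {μ : Measure (α × β)} {g : α × β → ℂ} (hg : Integrable g μ)
    (h : ∀ s t, MeasurableSet s → MeasurableSet t → ∫ x in s ×ˢ t, g x ∂μ = 0) :
    g =ᵐ[μ] 0 := by
  refine hg.ae_eq_zero_of_forall_setIntegral_eq_zero fun S hS hfin => ?_
  clear hfin
  have huniv : ∫ x, g x ∂μ = 0 := by
    simpa using h Set.univ Set.univ .univ .univ
  induction S, hS using MeasurableSpace.induction_on_inter generateFrom_prod.symm
    isPiSystem_prod with
  | empty => simp
  | basic S hS =>
    obtain ⟨s, hs, t, ht, rfl⟩ := hS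
    exact h s t hs ht
  | compl S hS ih =>
    have := integral_add_compl hS hg
    rw [ih, huniv, zero_add] at this
    exact this
  | iUnion f hd hm ih =>
    rw [integral_iUnion hm hd hg.integrableOn]
    simp [ih]

/-! ### Density of the elementary tensors -/

theorem inner_tensorFun_indicator {A B : Set R3} (hA : MeasurableSet A) (hB : MeasurableSet B)
    (hA' : volume A ≠ ⊤) (hB' : volume B ≠ ⊤) (g : L2R6) :
    ⟪tensorFun (indicatorConstLp 2 hA hA' 1) (indicatorConstLp 2 hB hB' 1), g⟫_ℂ =
      ∫ p in A ×ˢ B, g (WithLp.toLp 2 p) := by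
  rw [L2.inner_def, ← integral_indicator (hA.prod hB)]
  refine Eq.trans ?_ (integral_R6 fun q : R6 =>
    (A ×ˢ B).indicator (fun p => g (WithLp.toLp 2 p)) (WithLp.ofLp q))
  refine integral_congr_ae ?_
  filter_upwards [coeFn_tensorFun (indicatorConstLp 2 hA hA' 1) (indicatorConstLp 2 hB hB' 1),
    quasiMeasurePreserving_fst_R6.ae (indicatorConstLp_coeFn (hs := hA) (hμs := hA') (c := (1 : ℂ))
      (p := 2)),
    quasiMeasurePreserving_snd_R6.ae (indicatorConstLp_coeFn (hs := hB) (hμs := hB') (c := (1 : ℂ))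
      (p := 2))] with q h1 h2 h3
  rw [h1, h2, h3]
  by_cases ha : q.fst ∈ A
  · by_cases hb : q.snd ∈ B
    · have : WithLp.ofLp q ∈ A ×ˢ B := ⟨ha, hb⟩
      simp [ha, hb, this]
    · have : WithLp.ofLp q ∉ A ×ˢ B := fun h => hb h.2
      simp [hb, this]
  · have : WithLp.ofLp q ∉ A ×ˢ B := fun h => ha h.1
    simp [ha, this]

theorem eq_zero_of_forall_inner_tensorFun (g : L2R6)
    (h : ∀ u v, ⟪tensorFun u v, g⟫_ℂ = 0) : g = 0 := by
  set G : R3 × R3 → ℂ := fun p => g (WithLp.toLp 2 p)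
  have hG : MemLp G 2 (volume : Measure (R3 × R3)) :=
    (Lp.memLp g).comp_measurePreserving (WithLp.volume_preserving_toLp (U := R3) (V := R3))
  have hzero : ∀ n : ℕ, G =ᵐ[volume.restrict
      (Metric.closedBall (0 : R3) n ×ˢ Metric.closedBall (0 : R3) n)] 0 := by
    intro n
    set B := Metric.closedBall (0 : R3) n
    have hBm : MeasurableSet B := Metric.isClosed_closedBall.measurableSet
    have hBf : volume B < ⊤ := measure_closedBall_lt_top
    have hfin : volume (B ×ˢ B) < ⊤ := by
      rw [Measure.volume_eq_prod, Measure.prod_prod]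
      exact ENNReal.mul_lt_top hBf hBf
    have : IsFiniteMeasure (volume.restrict (B ×ˢ B)) := ⟨by simpa using hfin⟩
    refine ae_eq_zero_of_forall_setIntegral_prod ((hG.restrict _).integrable one_le_two) ?_
    intro s t hs ht
    rw [Measure.restrict_restrict (hs.prod ht), Set.prod_inter_prod,
      ← inner_tensorFun_indicator (hs.inter hBm) (ht.inter hBm)
        (measure_ne_top_of_subset Set.inter_subset_right hBf.ne)
        (measure_ne_top_of_subset Set.inter_subset_right hBf.ne), h]
  have hall : ∀ᵐ p : R3 × R3, G p = 0 := by
    have hU : (⋃ n : ℕ, Metric.closedBall (0 : R3) n ×ˢ Metric.closedBall (0 : R3) n) =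
        Set.univ := by
      refine Set.eq_univ_of_forall fun p => Set.mem_iUnion.2 ?_
      obtain ⟨n, hn⟩ := exists_nat_ge (max ‖p.1‖ ‖p.2‖)
      exact ⟨n, by simpa using (le_max_left _ _).trans hn, by simpa using (le_max_right _ _).trans hn⟩
    rw [← Measure.restrict_univ (μ := (volume : Measure (R3 × R3))), ← hU, ae_restrict_iUnion_iff]
    exact hzero
  refine Lp.ext ?_
  filter_upwards [Lp.coeFn_zero ℂ 2 (volume : Measure R6),
    (WithLp.volume_preserving_ofLp (U := R3) (V := R3)).quasiMeasurePreserving.ae hall]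
    with q h1 h2
  rw [h1]
  exact h2

/-- The span of the elementary tensors. -/
def tensorSpan : Submodule ℂ TwoParticle :=
  Submodule.span ℂ {f | ∃ u v : OneParticle, f = tensorVec u v}

theorem dense_tensorSpan : tensorSpan.topologicalClosure = ⊤ := by
  rw [Submodule.topologicalClosure_eq_top_iff, Submodule.eq_bot_iff]
  intro w hw
  ext1 s
  refine eq_zero_of_forall_inner_tensorFun _ fun a b => ?_
  have h := (Submodule.mem_orthogonal _ _).1 hw
    (tensorVec (PiLp.single 2 s.1 a) (PiLp.single 2 s.2 b))
    (Submodule.subset_span ⟨_, _, rfl⟩)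
  rw [PiLp.inner_apply, Finset.sum_eq_single s] at h
  · simpa [tensorVec] using h
  · intro t _ hts
    have h0 : tensorVec (PiLp.single 2 s.1 a) (PiLp.single 2 s.2 b) t = 0 := by
      change tensorFun _ _ = 0
      have : t.1 ≠ s.1 ∨ t.2 ≠ s.2 := by
        by_contra! hc
        exact hts (Prod.ext hc.1 hc.2)
      rw [← norm_eq_zero, norm_tensorFun]
      rcases this with hc | hc
      · simp [hc]
      · simp [hc]
    rw [h0, inner_zero_left]
  · simp

/-! ### Closures of operators given on a dense subspace of resolvent vectors -/

/-- The parametrization of the graph of the operator whose resolvent at `-i` is `T`. -/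
def cayleyGraph {H : Type*} [NormedAddCommGroup H] [NormedSpace ℂ H] (T : H →L[ℂ] H) :
    H →ₗ[ℂ] H × H :=
  (T : H →ₗ[ℂ] H).prod (LinearMap.id - I • (T : H →ₗ[ℂ] H))

theorem cayleyGraph_apply {H : Type*} [NormedAddCommGroup H] [NormedSpace ℂ H] (T : H →L[ℂ] H)
    (f : H) : cayleyGraph T f = (T f, f - I • T f) := rfl

theorem isCayley_closure {H : Type*} [NormedAddCommGroup H] [NormedSpace ℂ H] (T : H →L[ℂ] H)
    (hT : Function.Injective T) (D : Submodule ℂ H) (hD : D.topologicalClosure = ⊤) :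
    IsCayley (D.map (cayleyGraph T)).toLinearPMap.closure T := by
  set Γ := cayleyGraph T
  have hcont : Continuous Γ := by
    change Continuous fun f => (T f, f - I • T f)
    fun_prop
  have hrange : ∀ x : H × H, x ∈ LinearMap.range Γ ↔ T (x.2 + I • x.1) = x.1 := by
    intro x
    constructor
    · rintro ⟨f, rfl⟩
      simp [Γ, cayleyGraph_apply]
    · intro h
      exact ⟨x.2 + I • x.1, Prod.ext h (by simp [Γ, cayleyGraph_apply, h])⟩
  have hclosed : IsClosed (LinearMap.range Γ : Set (H × H)) := by
    have : (LinearMap.range Γ : Set (H × H)) = {x | T (x.2 + I • x.1) = x.1} :=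
      Set.ext hrange
    rw [this]
    exact isClosed_eq (by fun_prop) (by fun_prop)
  have hle : D.map Γ ≤ LinearMap.range Γ := LinearMap.map_le_range
  have hfun : ∀ x ∈ LinearMap.range Γ, x.1 = 0 → x.2 = 0 := by
    rintro _ ⟨f, rfl⟩ (h : T f = 0)
    have : f = 0 := hT (h.trans T.map_zero.symm)
    simp [this]
  have hg : (D.map Γ).toLinearPMap.graph = D.map Γ :=
    Submodule.toLinearPMap_graph_eq _ fun x hx => hfun x (hle hx)
  have hcl : (D.map Γ).topologicalClosure = LinearMap.range Γ := by
    refine le_antisymm (Submodule.topologicalClosure_minimal _ hle hclosed) ?_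
    rintro _ ⟨f, rfl⟩
    have hf : f ∈ closure (D : Set H) := by
      have : f ∈ D.topologicalClosure := hD ▸ Submodule.mem_top
      exact this
    exact map_mem_closure hcont hf fun a ha => Submodule.mem_map_of_mem ha
  have hclosable : (D.map Γ).toLinearPMap.IsClosable := by
    refine ⟨(LinearMap.range Γ).toLinearPMap, ?_⟩
    rw [hg, hcl, Submodule.toLinearPMap_graph_eq _ hfun]
  intro u w
  rw [← hclosable.graph_closure_eq_closure_graph, hg, hcl]
  constructor
  · rintro ⟨f, hf⟩
    exact ⟨f, (congrArg Prod.fst hf).symm, (congrArg Prod.snd hf).symm⟩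
  · rintro ⟨f, rfl, rfl⟩
    exact ⟨f, rfl⟩


theorem IsCayley.mem_domain {H : Type*} [NormedAddCommGroup H] [NormedSpace ℂ H]
    {A : H →ₗ.[ℂ] H} {r : H →L[ℂ] H} (h : IsCayley A r) (f : H) :
    ∃ u : A.domain, (u : H) = r f ∧ A u = f - I • r f := by
  have := (h (r f) (f - I • r f)).2 ⟨f, rfl, rfl⟩
  obtain ⟨y, hy1, hy2⟩ := (LinearPMap.mem_graph_iff _).1 this
  exact ⟨y, hy1, hy2⟩

theorem IsCayley.exists_eq {H : Type*} [NormedAddCommGroup H] [NormedSpace ℂ H]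
    {A : H →ₗ.[ℂ] H} {r : H →L[ℂ] H} (h : IsCayley A r) (u : A.domain) :
    ∃ f, (u : H) = r f ∧ A u = f - I • r f :=
  (h u (A u)).1 (A.mem_graph u)

theorem isCayley_tensorOp_left {A : OneParticle →ₗ.[ℂ] OneParticle}
    {r : OneParticle →L[ℂ] OneParticle} (hA : IsCayley A r) {T : TwoParticle →L[ℂ] TwoParticle}
    (hT : Function.Injective T) (hTr : ∀ u v, T (tensorVec u v) = tensorVec (r u) v) :
    IsCayley (tensorOp A oneOp) T := by
  have h : Submodule.span ℂ {p | ∃ (u : A.domain) (v : oneOp.domain),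
      p = (tensorVec u.1 v.1, tensorVec (A u) (oneOp v))} = tensorSpan.map (cayleyGraph T) := by
    rw [tensorSpan, Submodule.map_span]
    congr 1
    have hsub : ∀ u v, tensorVec (u - I • r u) v = tensorVec u v - I • tensorVec (r u) v := by
      intro u v
      ext1 s
      change tensorFun (u s.1 - I • r u s.1) (v s.2) = tensorFun _ _ - I • tensorFun _ _
      rw [sub_eq_add_neg, ← neg_smul, tensorFun_add_left, tensorFun_smul_left, neg_smul,
        ← sub_eq_add_neg]
    ext p
    constructor
    · rintro ⟨u, v, rfl⟩
      obtain ⟨f, h1, h2⟩ := hA.exists_eq u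
      refine ⟨tensorVec f v, ⟨f, v, rfl⟩, ?_⟩
      rw [cayleyGraph_apply, hTr, h1, h2, hsub]
      rfl
    · rintro ⟨_, ⟨u, v, rfl⟩, rfl⟩
      obtain ⟨y, h1, h2⟩ := hA.mem_domain u
      refine ⟨y, ⟨v, trivial⟩, ?_⟩
      rw [cayleyGraph_apply, hTr, h1, h2, hsub]
      rfl
  rw [tensorOp, algTensorOp, h]
  exact isCayley_closure T hT _ dense_tensorSpan

theorem isCayley_tensorOp_right {A : OneParticle →ₗ.[ℂ] OneParticle}
    {r : OneParticle →L[ℂ] OneParticle} (hA : IsCayley A r) {T : TwoParticle →L[ℂ] TwoParticle}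
    (hT : Function.Injective T) (hTr : ∀ u v, T (tensorVec u v) = tensorVec u (r v)) :
    IsCayley (tensorOp oneOp A) T := by
  have h : Submodule.span ℂ {p | ∃ (u : oneOp.domain) (v : A.domain),
      p = (tensorVec u.1 v.1, tensorVec (oneOp u) (A v))} = tensorSpan.map (cayleyGraph T) := by
    rw [tensorSpan, Submodule.map_span]
    congr 1
    have hsub : ∀ u v, tensorVec u (v - I • r v) = tensorVec u v - I • tensorVec u (r v) := by
      intro u v
      ext1 s
      change tensorFun (u s.1) (v s.2 - I • r v s.2) = tensorFun _ _ - I • tensorFun _ _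
      rw [sub_eq_add_neg, ← neg_smul, tensorFun_add_right, tensorFun_smul_right, neg_smul,
        ← sub_eq_add_neg]
    ext p
    constructor
    · rintro ⟨u, v, rfl⟩
      obtain ⟨f, h1, h2⟩ := hA.exists_eq v
      refine ⟨tensorVec u f, ⟨u, f, rfl⟩, ?_⟩
      rw [cayleyGraph_apply, hTr, h1, h2, hsub]
      rfl
    · rintro ⟨_, ⟨u, v, rfl⟩, rfl⟩
      obtain ⟨y, h1, h2⟩ := hA.mem_domain v
      refine ⟨⟨u, trivial⟩, y, ?_⟩
      rw [cayleyGraph_apply, hTr, h1, h2, hsub]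
      rfl
  rw [tensorOp, algTensorOp, h]
  exact isCayley_closure T hT _ dense_tensorSpan

/-- The resolvent of a sum of two commuting operators. -/
theorem isResolventAt_add {H : Type*} [NormedAddCommGroup H] [NormedSpace ℂ H]
    {A₁ A₂ : H →ₗ.[ℂ] H} {T₁ T₂ B₁ B₂ R : H →L[ℂ] H} {z : ℂ} (h₁ : IsCayley A₁ T₁)
    (h₂ : IsCayley A₂ T₂) (hR₁ : ∀ f, T₁ (B₁ f) = R f) (hR₂ : ∀ f, T₂ (B₂ f) = R f)
    (hB₁ : ∀ f, B₁ (T₁ f) = R f) (hB₂ : ∀ f, B₂ (T₂ f) = R f)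
    (hid : ∀ f, B₁ f + B₂ f - (2 * I + z) • R f = f) : IsResolventAt (A₁ + A₂) z R := by
  constructor
  · intro f
    obtain ⟨y₁, hy₁, hA₁⟩ := h₁.mem_domain (B₁ f)
    obtain ⟨y₂, hy₂, hA₂⟩ := h₂.mem_domain (B₂ f)
    rw [hR₁] at hy₁ hA₁
    rw [hR₂] at hy₂ hA₂
    have m₁ : R f ∈ A₁.domain := hy₁ ▸ y₁.2
    have m₂ : R f ∈ A₂.domain := hy₂ ▸ y₂.2
    have e₁ : y₁ = ⟨R f, m₁⟩ := Subtype.ext hy₁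
    have e₂ : y₂ = ⟨R f, m₂⟩ := Subtype.ext hy₂
    refine ⟨⟨R f, m₁, m₂⟩, rfl, ?_⟩
    rw [LinearPMap.add_apply]
    change A₁ ⟨R f, m₁⟩ + A₂ ⟨R f, m₂⟩ - z • R f = f
    rw [← e₁, ← e₂, hA₁, hA₂]
    refine Eq.trans ?_ (hid f)
    module
  · rintro ⟨u, m₁, m₂⟩
    obtain ⟨f₁, hf₁, hA₁⟩ := h₁.exists_eq ⟨u, m₁⟩
    obtain ⟨f₂, hf₂, hA₂⟩ := h₂.exists_eq ⟨u, m₂⟩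
    rw [LinearPMap.add_apply]
    change R (A₁ ⟨u, m₁⟩ + A₂ ⟨u, m₂⟩ - z • u) = u
    change u = T₁ f₁ at hf₁
    change u = T₂ f₂ at hf₂
    rw [hA₁, hA₂, ← hf₁, ← hf₂]
    have e₁ : R f₁ = B₁ u := by rw [hf₁, hB₁]
    have e₂ : R f₂ = B₂ u := by rw [hf₂, hB₂]
    simp only [map_sub, map_add, ContinuousLinearMap.map_smul, e₁, e₂]
    refine Eq.trans ?_ (hid u)
    module

/-! ### The resolvent of the two-particle operator without spin-orbit coupling -/

theorem diagOp_injective {ι H : Type*} [Fintype ι] [NormedAddCommGroup H] [NormedSpace ℂ H]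
    {T : ι → H →L[ℂ] H} (hT : ∀ i, Function.Injective (T i)) : Function.Injective (diagOp T) := by
  intro f g h
  ext1 i
  exact hT i (congrArg (fun w : PiLp 2 (fun _ : ι => H) => w i) h)

theorem measurable_fst_R6 : Measurable (fun q : R6 => q.fst) := by
  have : Continuous (fun q : R6 => q.fst) := by fun_prop
  exact this.measurable

theorem measurable_snd_R6 : Measurable (fun q : R6 => q.snd) := by
  have : Continuous (fun q : R6 => q.snd) := by fun_prop
  exact this.measurable

theorem measurable_symb_fst (β : ℝ) (s : Spin) : Measurable fun ξ : R6 => symb β s ξ.fst :=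
  (continuous_symb β s).measurable.comp measurable_fst_R6

theorem measurable_symb_snd (β : ℝ) (s : Spin) : Measurable fun ξ : R6 => symb β s ξ.snd :=
  (continuous_symb β s).measurable.comp measurable_snd_R6

theorem memLp_top_inv_symb_fst (β : ℝ) (s : Spin) :
    MemLp (fun ξ : R6 => ((symb β s ξ.fst : ℂ) + I)⁻¹) ⊤ (volume : Measure R6) := by
  have := measurable_symb_fst β s
  exact memLp_top_of_norm_le (by fun_prop) 1 fun ξ => norm_inv_ofReal_add_I_le _

theorem memLp_top_inv_symb_snd (β : ℝ) (s : Spin) :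
    MemLp (fun ξ : R6 => ((symb β s ξ.snd : ℂ) + I)⁻¹) ⊤ (volume : Measure R6) := by
  have := measurable_symb_snd β s
  exact memLp_top_of_norm_le (by fun_prop) 1 fun ξ => norm_inv_ofReal_add_I_le _

theorem ofReal_sub_ne_zero {z : ℂ} (hz : z.im ≠ 0) (x : ℝ) : (x : ℂ) - z ≠ 0 := by
  intro h
  have := congrArg Complex.im h
  simp [hz] at this

theorem norm_inv_ofReal_sub_le {z : ℂ} (hz : z.im ≠ 0) (x : ℝ) :
    ‖((x : ℂ) - z)⁻¹‖ ≤ |z.im|⁻¹ := by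
  rw [norm_inv]
  have h : |z.im| ≤ ‖(x : ℂ) - z‖ := by simpa using abs_im_le_norm ((x : ℂ) - z)
  exact inv_anti₀ (abs_pos.2 hz) h

theorem norm_ofReal_add_I_mul_inv_le {z : ℂ} (hz : z.im ≠ 0) {a x C : ℝ} (h : |a| ≤ |x| + C) :
    ‖((a : ℂ) + I) * ((x : ℂ) - z)⁻¹‖ ≤ 1 + (‖z‖ + |C| + 1) * |z.im|⁻¹ := by
  have h0 : 0 < ‖(x : ℂ) - z‖ := norm_pos_iff.2 (ofReal_sub_ne_zero hz x)
  have h1 : ‖(a : ℂ) + I‖ ≤ ‖(x : ℂ) - z‖ + (‖z‖ + |C| + 1) := by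
    calc ‖(a : ℂ) + I‖ ≤ |a| + 1 := by simpa using norm_add_le (a : ℂ) I
      _ ≤ |x| + |C| + 1 := by linarith [le_abs_self C]
      _ ≤ ‖(x : ℂ) - z‖ + (‖z‖ + |C| + 1) := by
        have := norm_add_le ((x : ℂ) - z) z
        rw [sub_add_cancel, Complex.norm_real, Real.norm_eq_abs] at this
        linarith
  have h2 := norm_inv_ofReal_sub_le hz x
  rw [norm_mul]
  calc ‖(a : ℂ) + I‖ * ‖((x : ℂ) - z)⁻¹‖
      ≤ (‖(x : ℂ) - z‖ + (‖z‖ + |C| + 1)) * ‖((x : ℂ) - z)⁻¹‖ := by gcongr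
    _ = 1 + (‖z‖ + |C| + 1) * ‖((x : ℂ) - z)⁻¹‖ := by
      rw [add_mul, norm_inv, mul_inv_cancel₀ h0.ne']
    _ ≤ _ := by gcongr

/-- The symbol of the component `s` of the two-particle operator. -/
def symb₂ (β : ℝ) (s : Spin × Spin) (ξ : R6) : ℝ := symb β s.1 ξ.fst + symb β s.2 ξ.snd

theorem symb₂_eq (β : ℝ) (s : Spin × Spin) (ξ : R6) :
    symb₂ β s ξ = (2 * Real.pi) ^ 2 * ‖ξ‖ ^ 2 + β * (spinSign s.1 + spinSign s.2) := by
  rw [symb₂, symb, symb, WithLp.prod_norm_sq_eq_of_L2]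
  ring

theorem measurable_symb₂ (β : ℝ) (s : Spin × Spin) : Measurable (symb₂ β s) :=
  (measurable_symb_fst β s.1).add (measurable_symb_snd β s.2)

theorem abs_spinSign (s : Spin) : |spinSign s| = 1 := by
  unfold spinSign
  split_ifs <;> simp

theorem abs_symb_fst_le (β : ℝ) (s : Spin × Spin) (ξ : R6) :
    |symb β s.1 ξ.fst| ≤ |symb₂ β s ξ| + 3 * |β| := by
  have h1 : |β * spinSign s.1| = |β| := by rw [abs_mul, abs_spinSign, mul_one]
  have h2 : |β * spinSign s.2| = |β| := by rw [abs_mul, abs_spinSign, mul_one]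
  have := le_abs_self (symb₂ β s ξ)
  have e := abs_le.1 h1.le
  have e' := abs_le.1 h2.le
  have p : 0 ≤ (2 * Real.pi) ^ 2 * ‖ξ.fst‖ ^ 2 := by positivity
  have p' : 0 ≤ (2 * Real.pi) ^ 2 * ‖ξ.snd‖ ^ 2 := by positivity
  rw [symb₂] at this ⊢
  rw [symb] at this ⊢
  rw [symb] at this ⊢
  rw [abs_le]
  have := abs_nonneg ((2 * Real.pi) ^ 2 * ‖ξ.fst‖ ^ 2 + β * spinSign s.1 +
    ((2 * Real.pi) ^ 2 * ‖ξ.snd‖ ^ 2 + β * spinSign s.2))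
  constructor <;> linarith [abs_nonneg β]

theorem abs_symb_snd_le (β : ℝ) (s : Spin × Spin) (ξ : R6) :
    |symb β s.2 ξ.snd| ≤ |symb₂ β s ξ| + 3 * |β| := by
  have := abs_symb_fst_le β (s.2, s.1) (WithLp.toLp 2 (ξ.snd, ξ.fst))
  have e : symb₂ β (s.2, s.1) (WithLp.toLp 2 (ξ.snd, ξ.fst)) = symb₂ β s ξ := add_comm _ _
  rwa [e] at this

theorem memLp_top_resolvent (β : ℝ) {z : ℂ} (hz : z.im ≠ 0) (s : Spin × Spin) :
    MemLp (fun ξ : R6 => ((symb₂ β s ξ : ℂ) - z)⁻¹) ⊤ (volume : Measure R6) := by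
  have := measurable_symb₂ β s
  exact memLp_top_of_norm_le (by fun_prop) _ fun ξ => norm_inv_ofReal_sub_le hz _

theorem memLp_top_resolvent_fst (β : ℝ) {z : ℂ} (hz : z.im ≠ 0) (s : Spin × Spin) :
    MemLp (fun ξ : R6 => ((symb β s.1 ξ.fst : ℂ) + I) * ((symb₂ β s ξ : ℂ) - z)⁻¹) ⊤
      (volume : Measure R6) := by
  have := measurable_symb₂ β s
  have := measurable_symb_fst β s.1
  exact memLp_top_of_norm_le (by fun_prop) _ fun ξ =>
    norm_ofReal_add_I_mul_inv_le hz (abs_symb_fst_le β s ξ)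

theorem memLp_top_resolvent_snd (β : ℝ) {z : ℂ} (hz : z.im ≠ 0) (s : Spin × Spin) :
    MemLp (fun ξ : R6 => ((symb β s.2 ξ.snd : ℂ) + I) * ((symb₂ β s ξ : ℂ) - z)⁻¹) ⊤
      (volume : Measure R6) := by
  have := measurable_symb₂ β s
  have := measurable_symb_snd β s.2
  exact memLp_top_of_norm_le (by fun_prop) _ fun ξ =>
    norm_ofReal_add_I_mul_inv_le hz (abs_symb_snd_le β s ξ)

theorem fourierMul_add_sub_smul {E : Type*} [NormedAddCommGroup E] [InnerProductSpace ℝ E]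
    [FiniteDimensional ℝ E] [MeasurableSpace E] [BorelSpace E] {m n k : E → ℂ} {c : ℂ}
    (hm : MemLp m ⊤ (volume : Measure E)) (hn : MemLp n ⊤ (volume : Measure E))
    (hk : MemLp k ⊤ (volume : Measure E)) (h : ∀ ξ, m ξ + n ξ - c * k ξ = 1)
    (f : Lp ℂ 2 (volume : Measure E)) :
    fourierMul hm f + fourierMul hn f - c • fourierMul hk f = f := by
  refine fourierL2_injective ?_
  filter_upwards [coeFn_fourierL2_sub (fourierMul hm f + fourierMul hn f) (c • fourierMul hk f),
    coeFn_fourierL2_add (fourierMul hm f) (fourierMul hn f),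
    coeFn_fourierL2_smul c (fourierMul hk f), fourier_fourierMul hm f,
    fourier_fourierMul hn f, fourier_fourierMul hk f] with ξ e1 e2 e3 e4 e5 e6
  rw [e1, e2, e3, e4, e5, e6]
  linear_combination fourierL2 E f ξ * h ξ

/-- The resolvent of the two-particle operator. -/
def twoParticleResolvent (β : ℝ) {z : ℂ} (hz : z.im ≠ 0) : TwoParticle →L[ℂ] TwoParticle :=
  diagOp fun s => fourierMul (memLp_top_resolvent β hz s)

theorem isResolventAt_twoParticleOp (β : ℝ) {z : ℂ} (hz : z.im ≠ 0) :
    IsResolventAt (twoParticleOp 0 β) z (twoParticleResolvent β hz) := by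
  have h₁ : IsCayley (tensorOp (rashba 0 β) oneOp)
      (diagOp fun s : Spin × Spin => fourierMul (memLp_top_inv_symb_fst β s.1)) := by
    refine isCayley_tensorOp_left (isCayley_rashba β) ?_ fun u v => ?_
    · exact diagOp_injective fun s =>
        fourierMul_injective _ fun ξ => inv_ne_zero (ofReal_add_I_ne_zero _)
    · ext1 s
      exact fourierMul_fst_tensorFun (memLp_top_inv_symb β s.1) _ _ _
  have h₂ : IsCayley (tensorOp oneOp (rashba 0 β))
      (diagOp fun s : Spin × Spin => fourierMul (memLp_top_inv_symb_snd β s.2)) := by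
    refine isCayley_tensorOp_right (isCayley_rashba β) ?_ fun u v => ?_
    · exact diagOp_injective fun s =>
        fourierMul_injective _ fun ξ => inv_ne_zero (ofReal_add_I_ne_zero _)
    · ext1 s
      exact fourierMul_snd_tensorFun (memLp_top_inv_symb β s.2) _ _ _
  refine isResolventAt_add
    (B₁ := diagOp fun s => fourierMul (memLp_top_resolvent_fst β hz s))
    (B₂ := diagOp fun s => fourierMul (memLp_top_resolvent_snd β hz s)) h₁ h₂
    (fun f => ?_) (fun f => ?_) (fun f => ?_) (fun f => ?_) (fun f => ?_)
  · ext1 s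
    exact fourierMul_comp _ _ _ (fun ξ => inv_mul_cancel_left₀ (ofReal_add_I_ne_zero _) _) _
  · ext1 s
    exact fourierMul_comp _ _ _ (fun ξ => inv_mul_cancel_left₀ (ofReal_add_I_ne_zero _) _) _
  · ext1 s
    rw [diagOp_apply, diagOp_apply, fourierMul_comm]
    exact fourierMul_comp _ _ _ (fun ξ => inv_mul_cancel_left₀ (ofReal_add_I_ne_zero _) _) _
  · ext1 s
    rw [diagOp_apply, diagOp_apply, fourierMul_comm]
    exact fourierMul_comp _ _ _ (fun ξ => inv_mul_cancel_left₀ (ofReal_add_I_ne_zero _) _) _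
  · ext1 s
    change fourierMul (memLp_top_resolvent_fst β hz s) (f s) +
      fourierMul (memLp_top_resolvent_snd β hz s) (f s) -
        (2 * I + z) • fourierMul (memLp_top_resolvent β hz s) (f s) = f s
    refine fourierMul_add_sub_smul _ _ _ (fun ξ => ?_) _
    have h0 := ofReal_sub_ne_zero hz (symb₂ β s ξ)
    have hs : (symb₂ β s ξ : ℂ) = symb β s.1 ξ.fst + symb β s.2 ξ.snd := by
      rw [symb₂, ofReal_add]
    field_simp
    rw [hs]
    ring

theorem IsResolventAt.unique {E : Type*} [NormedAddCommGroup E] [NormedSpace ℂ E]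
    {T : E →ₗ.[ℂ] E} {z : ℂ} {R R' : E →L[ℂ] E} (h : IsResolventAt T z R)
    (h' : IsResolventAt T z R') : R = R' := by
  ext f
  obtain ⟨u, hu, huf⟩ := h.1 f
  rw [← hu, ← h'.2 u, huf]

/-! ### The kernel of the free resolvent in six dimensions -/

/-- The complex heat kernel at time `s / κ`, up to normalization. -/
def heatKernel (κ : ℂ) (Q : R6) (s : ℝ) : ℂ :=
  ((s : ℂ) ^ 3)⁻¹ * cexp (-κ * s) * cexp (-(κ / (4 * s)) * (‖Q‖ : ℂ) ^ 2)

/-- The kernel of `(-Δ + κ²)⁻¹` on `ℝ⁶`. -/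
def freeKernel (κ : ℂ) (Q : R6) : ℂ :=
  κ ^ 2 / (64 * (Real.pi : ℂ) ^ 3) * ∫ s in Set.Ioi (0 : ℝ), heatKernel κ Q s

theorem finrank_R6 : Module.finrank ℝ R6 = 6 := by
  have : Module.finrank ℝ R6 = Module.finrank ℝ (R3 × R3) :=
    (WithLp.linearEquiv 2 ℝ (R3 × R3)).finrank_eq
  rw [this, Module.finrank_prod]
  simp

theorem norm_heatKernel {κ : ℂ} {s : ℝ} (hs : 0 < s) (Q : R6) :
    ‖heatKernel κ Q s‖ =
      (s ^ 3)⁻¹ * Real.exp (-κ.re * s) * Real.exp (-(κ.re / (4 * s)) * ‖Q‖ ^ 2) := by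
  have h1 : ‖((s : ℂ) ^ 3)⁻¹‖ = (s ^ 3)⁻¹ := by
    rw [norm_inv, norm_pow, Complex.norm_real, Real.norm_of_nonneg hs.le]
  have h2 : (-κ * s).re = -κ.re * s := by simp
  have h3 : (-(κ / (4 * s)) * (‖Q‖ : ℂ) ^ 2).re = -(κ.re / (4 * s)) * ‖Q‖ ^ 2 := by
    have : -(κ / (4 * s)) * (‖Q‖ : ℂ) ^ 2 = (((4 * s)⁻¹ * ‖Q‖ ^ 2 : ℝ) : ℂ) * (-κ) := by
      push_cast
      ring
    rw [this, re_ofReal_mul]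
    simp
    ring
  rw [heatKernel, norm_mul, norm_mul, h1, Complex.norm_exp, Complex.norm_exp, h2, h3]

theorem integral_norm_heatKernel {κ : ℂ} (hκ : 0 < κ.re) {s : ℝ} (hs : 0 < s) :
    ∫ Q, ‖heatKernel κ Q s‖ = (4 * Real.pi / κ.re) ^ 3 * Real.exp (-κ.re * s) := by
  simp_rw [norm_heatKernel hs, integral_const_mul]
  rw [GaussianFourier.integral_rexp_neg_mul_sq_norm (by positivity), finrank_R6,
    show (((6 : ℕ) : ℝ) / 2) = (3 : ℕ) by norm_num, Real.rpow_natCast]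
  field_simp

theorem integrable_heatKernel_left {κ : ℂ} (hκ : 0 < κ.re) {s : ℝ} (hs : 0 < s) :
    Integrable fun Q => heatKernel κ Q s := by
  have hb : 0 < (κ / (4 * s)).re := by
    have : κ / (4 * s) = (((4 * s)⁻¹ : ℝ) : ℂ) * κ := by
      push_cast
      ring
    rw [this, re_ofReal_mul]
    positivity
  have := (GaussianFourier.integrable_cexp_neg_mul_sq_norm_add hb 0 (0 : R6)).const_mul
    (((s : ℂ) ^ 3)⁻¹ * cexp (-κ * s))
  simpa [heatKernel] using this

theorem integrable_heatKernel {κ : ℂ} (hκ : 0 < κ.re) :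
    Integrable (fun p : R6 × ℝ => heatKernel κ p.1 p.2)
      (volume.prod (volume.restrict (Set.Ioi 0))) := by
  have hm : Measurable fun p : R6 × ℝ => heatKernel κ p.1 p.2 := by
    unfold heatKernel
    fun_prop
  rw [integrable_prod_iff' hm.aestronglyMeasurable]
  constructor
  · filter_upwards [ae_restrict_mem measurableSet_Ioi] with s hs
    exact integrable_heatKernel_left hκ hs
  · have h : IntegrableOn (fun s : ℝ => (4 * Real.pi / κ.re) ^ 3 * Real.exp (-κ.re * s))
        (Set.Ioi 0) := (exp_neg_integrableOn_Ioi 0 hκ).const_mul _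
    refine h.congr ?_
    filter_upwards [ae_restrict_mem measurableSet_Ioi] with s hs
    exact (integral_norm_heatKernel hκ hs).symm

theorem integrable_freeKernel {κ : ℂ} (hκ : 0 < κ.re) : Integrable (freeKernel κ) :=
  (integrable_heatKernel hκ).integral_prod_left.const_mul _

theorem fourier_const_mul {E : Type*} [NormedAddCommGroup E] [InnerProductSpace ℝ E]
    [FiniteDimensional ℝ E] [MeasurableSpace E] [BorelSpace E] (c : ℂ) (f : E → ℂ) (ξ : E) :
    𝓕 (fun x => c * f x) ξ = c * 𝓕 f ξ := by
  rw [Real.fourier_eq, Real.fourier_eq, ← integral_const_mul]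
  congr 1
  ext x
  simp only [Circle.smul_def, smul_eq_mul]
  ring

theorem ae_ne_zero_of_finrank_pos {E : Type*} [NormedAddCommGroup E] [InnerProductSpace ℝ E]
    [FiniteDimensional ℝ E] [MeasurableSpace E] [BorelSpace E] (h : 0 < Module.finrank ℝ E) :
    ∀ᵐ x : E, x ≠ 0 := by
  have : Nontrivial E := Module.nontrivial_of_finrank_pos h
  exact Measure.ae_ne volume 0

theorem fourier_heatKernel {κ : ℂ} (hκ : 0 < κ.re) {s : ℝ} (hs : 0 < s) (ξ : R6) :
    𝓕 (fun Q => heatKernel κ Q s) ξ =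
      (4 * Real.pi / κ) ^ 3 * cexp (-(κ + 4 * Real.pi ^ 2 * (‖ξ‖ : ℂ) ^ 2 / κ) * s) := by
  have hκ0 : κ ≠ 0 := by
    rintro rfl
    simp at hκ
  have hs0 : (s : ℂ) ≠ 0 := by exact_mod_cast hs.ne'
  have hb : 0 < (κ / (4 * s)).re := by
    have : κ / (4 * s) = (((4 * s)⁻¹ : ℝ) : ℂ) * κ := by
      push_cast
      ring
    rw [this, re_ofReal_mul]
    positivity
  have h := fourier_gaussian_innerProductSpace hb ξ
  rw [finrank_R6, show (((6 : ℕ) : ℂ) / 2) = ((3 : ℕ) : ℂ) by norm_num,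
    Complex.cpow_natCast] at h
  unfold heatKernel
  rw [fourier_const_mul, h]
  have e : -(κ + 4 * Real.pi ^ 2 * (‖ξ‖ : ℂ) ^ 2 / κ) * s =
      -κ * s + -Real.pi ^ 2 * (‖ξ‖ : ℂ) ^ 2 / (κ / (4 * s)) := by
    field_simp
    ring
  rw [e, Complex.exp_add]
  field_simp

theorem fourier_freeKernel {κ : ℂ} (hκ : 0 < κ.re) (ξ : R6) :
    𝓕 (freeKernel κ) ξ = ((2 * Real.pi) ^ 2 * (‖ξ‖ : ℂ) ^ 2 + κ ^ 2)⁻¹ := by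
  have hκ0 : κ ≠ 0 := by
    rintro rfl
    simp at hκ
  have hpi : (Real.pi : ℂ) ≠ 0 := by exact_mod_cast Real.pi_ne_zero
  have hre : (-(κ + 4 * Real.pi ^ 2 * (‖ξ‖ : ℂ) ^ 2 / κ)).re < 0 := by
    have h1 : 4 * Real.pi ^ 2 * (‖ξ‖ : ℂ) ^ 2 / κ = ((4 * Real.pi ^ 2 * ‖ξ‖ ^ 2 : ℝ) : ℂ) * κ⁻¹ := by
      push_cast
      ring
    rw [h1, neg_re, add_re, re_ofReal_mul, inv_re]
    have : 0 ≤ κ.re / normSq κ := div_nonneg hκ.le (normSq_nonneg _)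
    have : 0 ≤ 4 * Real.pi ^ 2 * ‖ξ‖ ^ 2 * (κ.re / normSq κ) := by positivity
    linarith
  have hswap : 𝓕 (fun Q => ∫ s in Set.Ioi (0 : ℝ), heatKernel κ Q s) ξ =
      ∫ s in Set.Ioi (0 : ℝ), 𝓕 (fun Q => heatKernel κ Q s) ξ := by
    simp_rw [Real.fourier_eq, Circle.smul_def, ← integral_smul]
    refine integral_integral_swap ?_
    have hc : Continuous fun p : R6 × ℝ => (Real.fourierChar (-⟪p.1, ξ⟫_ℝ) : ℂ) := by
      have := Real.continuous_fourierChar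
      fun_prop
    refine (integrable_heatKernel hκ).mono
      (hc.aestronglyMeasurable.smul (integrable_heatKernel hκ).aestronglyMeasurable) ?_
    filter_upwards with p
    exact ((norm_smul _ _).trans (by rw [Circle.norm_coe, one_mul])).le
  unfold freeKernel
  rw [fourier_const_mul, hswap, setIntegral_congr_fun measurableSet_Ioi
    fun s hs => fourier_heatKernel hκ hs ξ, integral_const_mul,
    integral_exp_mul_complex_Ioi hre]
  have hne : κ + 4 * Real.pi ^ 2 * (‖ξ‖ : ℂ) ^ 2 / κ ≠ 0 := by
    intro h
    rw [h] at hre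
    simp at hre
  have hne' : (2 * Real.pi) ^ 2 * (‖ξ‖ : ℂ) ^ 2 + κ ^ 2 ≠ 0 := by
    have : (2 * Real.pi) ^ 2 * (‖ξ‖ : ℂ) ^ 2 + κ ^ 2 =
      κ * (κ + 4 * Real.pi ^ 2 * (‖ξ‖ : ℂ) ^ 2 / κ) := by
      field_simp
      ring
    rw [this]
    exact mul_ne_zero hκ0 hne
  simp only [ofReal_zero, mul_zero, Complex.exp_zero, neg_div_neg_eq]
  have e : κ + 4 * Real.pi ^ 2 * (‖ξ‖ : ℂ) ^ 2 / κ =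
      ((2 * Real.pi) ^ 2 * (‖ξ‖ : ℂ) ^ 2 + κ ^ 2) / κ := by
    field_simp
    ring
  rw [e]
  field_simp
  norm_num

theorem integral_heatKernel_eq_macdonald {κ : ℂ} {Q : R6} (hQ : Q ≠ 0)
    (hint : IntegrableOn (heatKernel κ Q) (Set.Ioi 0)) :
    ∫ s in Set.Ioi (0 : ℝ), heatKernel κ Q s =
      8 / (‖Q‖ : ℂ) ^ 2 * macdonald 2 (‖Q‖ * κ) := by
  set r := ‖Q‖
  have hr : 0 < r := norm_pos_iff.2 hQ
  have hr0 : (r : ℂ) ≠ 0 := by exact_mod_cast hr.ne'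
  set φ : ℝ → ℝ := fun t => r / 2 * Real.exp t
  set g : ℝ → ℂ := fun t => cexp (-(2 * t)) * cexp (-(r * κ) * Complex.cosh t)
  have himage : φ '' Set.univ = Set.Ioi 0 := by
    ext s
    constructor
    · rintro ⟨t, -, rfl⟩
      have : 0 < r / 2 * Real.exp t := by positivity
      exact this
    · intro hs
      have hs : 0 < s := hs
      refine ⟨Real.log (s / (r / 2)), trivial, ?_⟩
      simp only [φ]
      rw [Real.exp_log (by positivity)]
      field_simp
  have hderiv : ∀ t ∈ Set.univ, HasDerivWithinAt φ (φ t) Set.univ t := fun t _ =>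
    ((Real.hasDerivAt_exp t).const_mul _).hasDerivWithinAt
  have hinj : Set.InjOn φ Set.univ := by
    intro a _ b _ hab
    exact Real.exp_injective (mul_left_cancel₀ (by positivity) hab)
  have hval : ∀ t, |φ t| • heatKernel κ Q (φ t) = 4 / (r : ℂ) ^ 2 * g t := by
    intro t
    have hφ : 0 < φ t := by positivity
    have he : Complex.exp t ≠ 0 := Complex.exp_ne_zero _
    have hcφ : ((φ t : ℝ) : ℂ) = r / 2 * cexp t := by simp [φ]
    have h2 : cexp (-(2 * t)) = (cexp t ^ 2)⁻¹ := by
      rw [Complex.exp_neg, ← Complex.exp_nat_mul]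
      norm_num
    have hc : -(r * κ) * Complex.cosh t =
        -κ * (r / 2 * cexp t) + -(κ / (4 * (r / 2 * cexp t))) * (r : ℂ) ^ 2 := by
      rw [Complex.cosh, Complex.exp_neg]
      field_simp
      ring
    rw [abs_of_pos hφ, Complex.real_smul, heatKernel, hcφ, show ‖Q‖ = r from rfl]
    simp only [g]
    rw [hc, Complex.exp_add, h2]
    field_simp
    ring
  have hsub : ∫ s in Set.Ioi (0 : ℝ), heatKernel κ Q s = ∫ t, 4 / (r : ℂ) ^ 2 * g t := by
    rw [← himage, integral_image_eq_integral_abs_deriv_smul MeasurableSet.univ hderiv hinj,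
      Measure.restrict_univ]
    simp_rw [hval]
  have hgi : Integrable g := by
    rw [← himage, integrableOn_image_iff_integrableOn_abs_deriv_smul MeasurableSet.univ hderiv
      hinj, integrableOn_univ] at hint
    simp_rw [hval] at hint
    refine (hint.const_mul ((r : ℂ) ^ 2 / 4)).congr (Eventually.of_forall fun t => ?_)
    field_simp
  have hg : ∫ t, g t = 2 * macdonald 2 (r * κ) := by
    have h1 : ∫ t in Set.Iic (0 : ℝ), g t = ∫ t in Set.Ioi (0 : ℝ), g (-t) := by simp
    have hgn : IntegrableOn (fun t => g (-t)) (Set.Ioi 0) := hgi.comp_neg.integrableOn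
    rw [← intervalIntegral.integral_Iic_add_Ioi (b := 0) hgi.integrableOn hgi.integrableOn, h1,
      ← integral_add hgn hgi.integrableOn, macdonald, ← integral_const_mul]
    congr 1
    ext t
    simp only [g, ofReal_neg, Complex.cosh_neg]
    rw [Complex.cosh.eq_1 (2 * t)]
    ring_nf
  rw [hsub, integral_const_mul, hg]
  ring

theorem freeKernel_eq_macdonald {κ : ℂ} (hκ : 0 < κ.re) :
    ∀ᵐ Q : R6, freeKernel κ Q =
      κ ^ 2 / (8 * (Real.pi : ℂ) ^ 3 * (‖Q‖ : ℂ) ^ 2) * macdonald 2 (‖Q‖ * κ) := by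
  have h0 : ∀ᵐ Q : R6, Q ≠ 0 := ae_ne_zero_of_finrank_pos (by rw [finrank_R6]; norm_num)
  filter_upwards [h0, (integrable_heatKernel hκ).prod_right_ae] with Q hQ hi
  rw [freeKernel, integral_heatKernel_eq_macdonald hQ hi]
  have hpi : (Real.pi : ℂ) ≠ 0 := by exact_mod_cast Real.pi_ne_zero
  have hr0 : (‖Q‖ : ℂ) ≠ 0 := by exact_mod_cast (norm_pos_iff.2 hQ).ne'
  field_simp
  norm_num

/-! ### Convolution operators as Fourier multipliers -/

theorem mul_indicator_eq {E : Type*} [Sub E] (k f : E → ℂ) (B : Set E) (x : E) :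
    (fun y => k (x - y) * B.indicator f y) = B.indicator fun y => k (x - y) * f y := by
  ext y
  by_cases hy : y ∈ B
  · simp [hy]
  · simp [hy]

section Convolution

variable {E : Type*} [NormedAddCommGroup E] [InnerProductSpace ℝ E] [FiniteDimensional ℝ E]
  [MeasurableSpace E] [BorelSpace E]

/-- An integrable function whose Fourier integral is the Fourier transform of an `L²` function `g`
equals `g`. -/
theorem ae_eq_of_fourier_ae_eq {h : E → ℂ} {g : Lp ℂ 2 (volume : Measure E)}
    (hh : Integrable h) (H : 𝓕 h =ᵐ[volume] fourierL2 E g) : h =ᵐ[volume] g := by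
  have hg : LocallyIntegrable g (volume : Measure E) := (Lp.memLp _).locallyIntegrable one_le_two
  refine ae_eq_of_integral_contDiff_smul_eq hh.locallyIntegrable hg fun φ hφ hφc => ?_
  have hg₁ : HasCompactSupport (Complex.ofRealCLM ∘ φ) := hφc.comp_left rfl
  have hg₂ : ContDiff ℝ ∞ (Complex.ofRealCLM ∘ φ) := by fun_prop
  set ψ : 𝓢(E, ℂ) := 𝓕⁻ (hg₁.toSchwartzMap hg₂)
  have hψ : 𝓕 ψ = hg₁.toSchwartzMap hg₂ := by simp [ψ]
  have hψ' : ∀ x, 𝓕 (ψ : E → ℂ) x = φ x := fun x => by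
    rw [← SchwartzMap.fourier_coe, hψ]
    simp
  have e1 := VectorFourier.integral_fourierIntegral_smul_eq_flip (L := innerₗ E)
    (μ := (volume : Measure E)) (ν := volume)
    Real.continuous_fourierChar continuous_inner ψ.integrable hh
  rw [flip_innerₗ] at e1
  have e2 := congrArg (fun T => T ψ) (Lp.fourier_toTemperedDistribution_eq g)
  simp only [TemperedDistribution.fourier_apply, Lp.toTemperedDistribution_apply] at e2
  calc ∫ x, φ x • h x = ∫ x, 𝓕 (ψ : E → ℂ) x • h x := by simp_rw [hψ']; rfl
    _ = ∫ x, ψ x • 𝓕 h x := e1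
    _ = ∫ x, ψ x • fourierL2 E g x := by
      refine integral_congr_ae ?_
      filter_upwards [H] with x hx
      rw [hx]
    _ = ∫ x, (𝓕 ψ) x • g x := e2.symm
    _ = ∫ x, φ x • g x := by simp_rw [SchwartzMap.fourier_coe, hψ']; rfl

theorem convolution_ae_eq_fourierMul {k m : E → ℂ} (hk : Integrable k)
    (hm : MemLp m ⊤ (volume : Measure E)) (hkm : ∀ ξ, 𝓕 k ξ = m ξ)
    {f : Lp ℂ 2 (volume : Measure E)} (hf : Integrable f volume) :
    (fun x => ∫ y, k (x - y) * f y) =ᵐ[volume] fourierMul hm f := by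
  have hc : (fun x => ∫ y, k (x - y) * f y) =
      (f : E → ℂ) ⋆[ContinuousLinearMap.mul ℂ ℂ, volume] k := by
    ext x
    rw [convolution_def]
    congr 1
    ext y
    rw [ContinuousLinearMap.mul_apply', mul_comm]
  rw [hc]
  refine ae_eq_of_fourier_ae_eq (hf.integrable_convolution _ hk) ?_
  filter_upwards [fourier_fourierMul hm f, coeFn_fourierL2_of_integrable hf] with ξ h1 h2
  rw [h1, h2, Real.fourier_mul_convolution_eq hf hk, hkm, mul_comm]

theorem memLp_indicator_closedBall (f : Lp ℂ 2 (volume : Measure E)) (r : ℝ) :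
    MemLp ((Metric.closedBall (0 : E) r).indicator f) 2 :=
  (Lp.memLp f).indicator Metric.isClosed_closedBall.measurableSet

/-- The truncation of an `L²` function to a ball. -/
def truncBall (f : Lp ℂ 2 (volume : Measure E)) (r : ℝ) : Lp ℂ 2 (volume : Measure E) :=
  (memLp_indicator_closedBall f r).toLp _

theorem coeFn_truncBall (f : Lp ℂ 2 (volume : Measure E)) (r : ℝ) :
    truncBall f r =ᵐ[volume] (Metric.closedBall (0 : E) r).indicator f :=
  (memLp_indicator_closedBall f r).coeFn_toLp

theorem integrable_truncBall (f : Lp ℂ 2 (volume : Measure E)) (r : ℝ) :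
    Integrable (truncBall f r) volume := by
  refine Integrable.congr ?_ (coeFn_truncBall f r).symm
  rw [integrable_indicator_iff Metric.isClosed_closedBall.measurableSet]
  have : IsFiniteMeasure ((volume : Measure E).restrict (Metric.closedBall 0 r)) :=
    ⟨by simpa using measure_closedBall_lt_top⟩
  exact ((Lp.memLp f).restrict _).integrable one_le_two

theorem tendsto_truncBall (f : Lp ℂ 2 (volume : Measure E)) :
    Tendsto (truncBall f) atTop (𝓝 f) := by
  rw [tendsto_iff_norm_sub_tendsto_zero]
  have hsq : Tendsto (fun r => ‖truncBall f r - f‖ ^ 2) atTop (𝓝 0) := by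
    have h1 : ∀ r, ‖truncBall f r - f‖ ^ 2 =
        ∫ x, ‖(Metric.closedBall (0 : E) r).indicator f x - f x‖ ^ 2 := by
      intro r
      rw [norm_sq_Lp_two]
      refine integral_congr_ae ?_
      filter_upwards [Lp.coeFn_sub (truncBall f r) f, coeFn_truncBall f r] with x h1 h2
      rw [h1, Pi.sub_apply, h2]
    simp_rw [h1]
    have hz : (0 : ℝ) = ∫ x : E, 0 := by simp
    rw [hz]
    have hfm := Lp.aestronglyMeasurable f
    refine tendsto_integral_filter_of_dominated_convergence (fun x => ‖f x‖ ^ 2) ?_ ?_ ?_ ?_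
    · refine Eventually.of_forall fun r => ?_
      exact ((hfm.indicator Metric.isClosed_closedBall.measurableSet).sub hfm).norm.pow 2
    · refine Eventually.of_forall fun r => Eventually.of_forall fun x => ?_
      by_cases hx : x ∈ Metric.closedBall (0 : E) r
      · simp [Set.indicator_of_mem hx]
      · simp [Set.indicator_of_notMem hx]
    · exact (memLp_two_iff_integrable_sq_norm hfm).1 (Lp.memLp f)
    · refine Eventually.of_forall fun x => tendsto_const_nhds.congr' ?_
      filter_upwards [eventually_ge_atTop ‖x‖] with r hr
      have hx : x ∈ Metric.closedBall (0 : E) r := by simpa using hr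
      simp [Set.indicator_of_mem hx]
  have := hsq.sqrt
  simpa using this

theorem tendsto_eLpNorm_convolution {k m : E → ℂ} (hk : Integrable k)
    (hm : MemLp m ⊤ (volume : Measure E)) (hkm : ∀ ξ, 𝓕 k ξ = m ξ)
    (f : Lp ℂ 2 (volume : Measure E)) :
    Tendsto (fun r : ℝ => eLpNorm (fun x => (∫ y in Metric.closedBall (0 : E) r, k (x - y) * f y) -
      fourierMul hm f x) 2 volume) atTop (𝓝 0) := by
  have h : ∀ r : ℝ, eLpNorm (fun x => (∫ y in Metric.closedBall (0 : E) r, k (x - y) * f y) -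
      fourierMul hm f x) 2 volume =
        ENNReal.ofReal ‖fourierMul hm (truncBall f r) - fourierMul hm f‖ := by
    intro r
    rw [Lp.norm_def, ENNReal.ofReal_toReal (Lp.eLpNorm_ne_top _)]
    refine eLpNorm_congr_ae ?_
    filter_upwards [Lp.coeFn_sub (fourierMul hm (truncBall f r)) (fourierMul hm f),
      convolution_ae_eq_fourierMul hk hm hkm (integrable_truncBall f r)] with x h1 h2
    rw [h1, Pi.sub_apply, ← h2, ← integral_indicator Metric.isClosed_closedBall.measurableSet,
      ← mul_indicator_eq]
    congr 1
    refine integral_congr_ae ?_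
    filter_upwards [coeFn_truncBall f r] with y hy
    rw [hy]
  simp_rw [h]
  rw [← ENNReal.ofReal_zero]
  refine ENNReal.tendsto_ofReal ?_
  rw [← tendsto_iff_norm_sub_tendsto_zero]
  exact ((fourierMul hm).continuous.tendsto f).comp (tendsto_truncBall f)

theorem integrableOn_convolution {k : E → ℂ} (hk : Integrable k)
    (f : Lp ℂ 2 (volume : Measure E)) (r : ℝ) :
    ∀ᵐ x, IntegrableOn (fun y => k (x - y) * f y) (Metric.closedBall 0 r) := by
  have h := (integrable_truncBall f r).ae_convolution_exists (ContinuousLinearMap.mul ℂ ℂ) hk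
  filter_upwards [h] with x hx
  rw [← integrable_indicator_iff Metric.isClosed_closedBall.measurableSet, ← mul_indicator_eq]
  refine Integrable.congr hx ?_
  filter_upwards [coeFn_truncBall f r] with y hy
  rw [hy, ContinuousLinearMap.mul_apply', mul_comm]

theorem continuous_convolution_kernel {k : E → ℂ} (hk : LocallyIntegrable k) {φ : E → ℂ}
    (hφ : Continuous φ) (hφc : HasCompactSupport φ) :
    Continuous fun x => ∫ y, k (x - y) * φ y := by
  have h := hφc.continuous_convolution_left (ContinuousLinearMap.mul ℂ ℂ) hφ hk (μ := volume)
  convert h using 1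
  ext x
  rw [convolution_def]
  congr 1
  ext y
  rw [ContinuousLinearMap.mul_apply', mul_comm]

/-- A locally integrable kernel is determined by its convolutions with test functions. -/
theorem ae_eq_of_forall_convolution_ae_eq {k l : E → ℂ} (hk : LocallyIntegrable k)
    (hl : LocallyIntegrable l)
    (h : ∀ φ : E → ℂ, Continuous φ → HasCompactSupport φ →
      (fun x => ∫ y, k (x - y) * φ y) =ᵐ[volume] fun x => ∫ y, l (x - y) * φ y) :
    k =ᵐ[volume] l := by
  refine ae_eq_of_integral_contDiff_smul_eq hk hl fun φ hφ hφc => ?_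
  set ψ : E → ℂ := fun y => φ (-y)
  have hψ : Continuous ψ := by
    have := hφ.continuous
    fun_prop
  have hψc : HasCompactSupport ψ := by
    have h1 : HasCompactSupport (fun y => φ (-y)) := hφc.comp_homeomorph (Homeomorph.neg E)
    exact h1.comp_left (g := fun x : ℝ => (x : ℂ)) ofReal_zero
  have heq := (Continuous.ae_eq_iff_eq volume
    (continuous_convolution_kernel hk hψ hψc) (continuous_convolution_kernel hl hψ hψc)).1 (h ψ hψ hψc)
  have h0 := congrFun heq 0
  simp only [zero_sub] at h0
  have hneg : ∀ j : E → ℂ, ∫ y, j (-y) * ψ y = ∫ x, φ x • j x := by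
    intro j
    rw [← integral_neg_eq_self]
    congr 1
    ext y
    simp [ψ, mul_comm]
  rwa [hneg, hneg] at h0

end Convolution

theorem isLimConv_of_fourier {k m : R6 → ℂ} (hk : Integrable k)
    (hm : MemLp m ⊤ (volume : Measure R6)) (hkm : ∀ ξ, 𝓕 k ξ = m ξ) (f : L2R6) :
    IsLimConv k f (fourierMul hm f) :=
  ⟨integrableOn_convolution hk f, tendsto_eLpNorm_convolution hk hm hkm f⟩

theorem IsLimConv.convolution_ae_eq {k : R6 → ℂ} (hk : LocallyIntegrable k) {φ : R6 → ℂ}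
    (hφ : Continuous φ) (hφc : HasCompactSupport φ) {f g : L2R6} (hf : f =ᵐ[volume] φ)
    (h : IsLimConv k f g) : (fun x => ∫ y, k (x - y) * φ y) =ᵐ[volume] g := by
  obtain ⟨r₀, hr₀⟩ := hφc.isCompact.isBounded.subset_closedBall (0 : R6)
  have hev : ∀ r, r₀ ≤ r → ∀ x, ∫ y in Metric.closedBall (0 : R6) r, k (x - y) * f y =
      ∫ y, k (x - y) * φ y := by
    intro r hr x
    rw [← integral_indicator Metric.isClosed_closedBall.measurableSet]
    refine integral_congr_ae ?_
    filter_upwards [hf] with y hy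
    by_cases hyr : y ∈ Metric.closedBall (0 : R6) r
    · rw [Set.indicator_of_mem hyr, hy]
    · have : φ y = 0 := by
        by_contra h0
        exact hyr (Metric.closedBall_subset_closedBall hr (hr₀ (subset_tsupport _ h0)))
      rw [Set.indicator_of_notMem hyr, this, mul_zero]
  have hconst : Tendsto (fun _ : ℝ => eLpNorm (fun x => (∫ y, k (x - y) * φ y) - g x) 2 volume)
      atTop (𝓝 0) := by
    refine h.2.congr' ?_
    filter_upwards [eventually_ge_atTop r₀] with r hr
    simp_rw [hev r hr]
  have hzero := tendsto_nhds_unique tendsto_const_nhds hconst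
  have hcont := continuous_convolution_kernel hk hφ hφc
  filter_upwards [(eLpNorm_eq_zero_iff (hcont.aestronglyMeasurable.sub
    (Lp.aestronglyMeasurable g)) two_ne_zero).1 hzero] with x hx
  exact sub_eq_zero.1 hx

theorem ae_eq_of_forall_isLimConv {k l : R6 → ℂ} (hk : LocallyIntegrable k)
    (hl : LocallyIntegrable l) (h : ∀ f : L2R6, ∃ g, IsLimConv k f g ∧ IsLimConv l f g) :
    k =ᵐ[volume] l := by
  refine ae_eq_of_forall_convolution_ae_eq hk hl fun φ hφ hφc => ?_
  have hL : MemLp φ 2 (volume : Measure R6) := hφ.memLp_of_hasCompactSupport hφc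
  obtain ⟨g, h1, h2⟩ := h (hL.toLp φ)
  exact (h1.convolution_ae_eq hk hφ hφc hL.coeFn_toLp).trans
    (h2.convolution_ae_eq hl hφ hφc hL.coeFn_toLp).symm

/-! ### The Green function -/

theorem csqrt_sq (w : ℂ) : csqrt w ^ 2 = w := by
  rw [csqrt, ← Complex.cpow_nat_mul]
  norm_num

theorem csqrt_re_pos {w : ℂ} (hw : w.im ≠ 0) : 0 < (csqrt w).re := by
  have h0 : w ≠ 0 := by
    rintro rfl
    simp at hw
  have hlog : (Complex.log w * (1 / 2)).im = arg w / 2 := by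
    have : Complex.log w * (1 / 2) = ((1 / 2 : ℝ) : ℂ) * Complex.log w := by
      push_cast
      ring
    rw [this, im_ofReal_mul, log_im]
    ring
  rw [csqrt, cpow_def_of_ne_zero h0, exp_re, hlog]
  have h1 : arg w < Real.pi :=
    lt_of_le_of_ne (arg_le_pi w) fun h => hw (arg_eq_pi_iff.1 h).2
  have h2 := neg_pi_lt_arg w
  have := Real.cos_pos_of_mem_Ioo (x := arg w / 2) ⟨by linarith, by linarith⟩
  positivity

/-- The symbol of the free resolvent `(-Δ - w)⁻¹` is essentially bounded. -/
theorem memLp_top_freeResolvent {w : ℂ} (hw : w.im ≠ 0) :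
    MemLp (fun ξ : R6 => ((((2 * Real.pi) ^ 2 * ‖ξ‖ ^ 2 : ℝ) : ℂ) - w)⁻¹) ⊤ volume :=
  memLp_top_of_norm_le (by fun_prop) _ fun _ => norm_inv_ofReal_sub_le hw _

/-- The free resolvent `(-Δ - w)⁻¹` on `L²(ℝ⁶)`. -/
def freeResolvent {w : ℂ} (hw : w.im ≠ 0) : L2R6 →L[ℂ] L2R6 :=
  fourierMul (memLp_top_freeResolvent hw)

theorem isLimConv_freeResolvent {w : ℂ} (hw : w.im ≠ 0) (f : L2R6) :
    IsLimConv (freeKernel (csqrt (-w))) f (freeResolvent hw f) := by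
  have hre : 0 < (csqrt (-w)).re := csqrt_re_pos (by simpa using hw)
  refine isLimConv_of_fourier (integrable_freeKernel hre) _ (fun ξ => ?_) f
  rw [fourier_freeKernel hre, csqrt_sq]
  push_cast
  rw [sub_eq_add_neg]

/-- The spectral parameter of the channel `σ`. -/
def channelParam (β : ℝ) (z : ℂ) (σ : Coupled) : ℂ := z - 2 * β * σ.s

theorem channelParam_im (β : ℝ) (z : ℂ) (σ : Coupled) : (channelParam β z σ).im = z.im := by
  have : channelParam β z σ = z - ((2 * β * σ.s : ℝ) : ℂ) := by
    simp [channelParam]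
  rw [this, sub_im, ofReal_im, sub_zero]

theorem spinSign_add_of_clebschGordan_ne_zero {s : Spin × Spin} {σ : Coupled}
    (h : clebschGordan s.1 s.2 σ ≠ 0) : spinSign s.1 + spinSign s.2 = 2 * σ.s := by
  obtain ⟨s₁, s₂⟩ := s
  revert h
  cases σ <;> fin_cases s₁ <;> fin_cases s₂ <;>
    norm_num [clebschGordan, spinSign, Coupled.s]

theorem twoParticleResolvent_component (β : ℝ) {z : ℂ} (hz : z.im ≠ 0) {s : Spin × Spin}
    {σ : Coupled} (hσ : (channelParam β z σ).im ≠ 0) (h : clebschGordan s.1 s.2 σ ≠ 0)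
    (f : L2R6) : fourierMul (memLp_top_resolvent β hz s) f = freeResolvent hσ f := by
  refine eq_fourierMul _ ?_
  filter_upwards [fourier_fourierMul (memLp_top_resolvent β hz s) f] with ξ hξ
  rw [hξ, symb₂_eq, spinSign_add_of_clebschGordan_ne_zero h, channelParam]
  congr 2
  push_cast
  ring

theorem comCoupledMap_apply (w : TwoParticle) (σ : Coupled) :
    comCoupledMap w σ = ∑ s₁, ∑ s₂, clebschGordan s₁ s₂ σ • comUnitary (w (s₁, s₂)) := by
  change (∑ s₁, ∑ s₂, clebschGordan s₁ s₂ σ •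
    (comUnitary ∘L PiLp.proj 2 (fun _ : Spin × Spin => L2R6) (s₁, s₂))) w = _
  simp

/-- The two-particle vector with spin state `|σ⟩` and wave function `f`. -/
def coupledVec (f : L2R6) (σ : Coupled) : TwoParticle :=
  WithLp.toLp 2 fun s => clebschGordan s.1 s.2 σ • f

theorem conj_clebschGordan (s₁ s₂ : Spin) (σ : Coupled) :
    (starRingEnd ℂ) (clebschGordan s₁ s₂ σ) = clebschGordan s₁ s₂ σ := by
  cases σ <;> unfold clebschGordan <;> split_ifs <;> simp

theorem clebschGordan_orthogonal (σ' σ : Coupled) :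
    ∑ s₁, ∑ s₂, clebschGordan s₁ s₂ σ' * clebschGordan s₁ s₂ σ = kron σ' σ := by
  have h2 : ((√2 : ℝ) : ℂ)⁻¹ * ((√2 : ℝ) : ℂ)⁻¹ = 1 / 2 := by
    rw [← mul_inv, ← ofReal_mul, Real.mul_self_sqrt (by norm_num)]
    norm_num
  cases σ' <;> cases σ <;> simp [Fin.sum_univ_two, clebschGordan, kron, h2] <;> norm_num

theorem comCoupledMap_coupledVec (f : L2R6) (σ : Coupled) :
    comCoupledMap (coupledVec f σ) = tensorKet (comUnitary f) σ := by
  ext1 σ'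
  rw [comCoupledMap_apply]
  change ∑ s₁, ∑ s₂, clebschGordan s₁ s₂ σ' • comUnitary (clebschGordan s₁ s₂ σ • f) =
    (Pi.single σ (comUnitary f) : Coupled → L2R6) σ'
  simp_rw [map_smul, smul_smul, ← Finset.sum_smul]
  rw [clebschGordan_orthogonal, kron]
  by_cases h : σ' = σ
  · subst h
    simp
  · simp [h]

theorem inner_comUnitary (f g : L2R6) : ⟪comUnitary f, comUnitary g⟫_ℂ = ⟪f, g⟫_ℂ :=
  (Lp.compMeasurePreservingₗᵢ ℂ comMap measurePreserving_comMap).inner_map_map f g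

theorem comUnitary_injective : Function.Injective comUnitary :=
  fun _ _ h => (Lp.compMeasurePreservingₗᵢ ℂ comMap measurePreserving_comMap).injective h

theorem adjoint_comCoupledMap_tensorKet (f : L2R6) (σ : Coupled) :
    ContinuousLinearMap.adjoint comCoupledMap (tensorKet (comUnitary f) σ) = coupledVec f σ := by
  refine ext_inner_right ℂ fun w => ?_
  rw [ContinuousLinearMap.adjoint_inner_left, PiLp.inner_apply, PiLp.inner_apply,
    Finset.sum_eq_single σ]
  · have h : tensorKet (comUnitary f) σ σ = comUnitary f := by simp [tensorKet]
    rw [h, comCoupledMap_apply]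
    simp_rw [inner_sum, inner_smul_right, inner_comUnitary]
    rw [Fintype.sum_prod_type]
    refine Finset.sum_congr rfl fun s₁ _ => Finset.sum_congr rfl fun s₂ _ => ?_
    change _ = ⟪clebschGordan s₁ s₂ σ • f, w (s₁, s₂)⟫_ℂ
    rw [inner_smul_left, conj_clebschGordan]
  · intro τ _ hτ
    have h : tensorKet (comUnitary f) σ τ = 0 := by simp [tensorKet, hτ]
    rw [h, inner_zero_left]
  · simp

theorem comConj_resolvent (β : ℝ) {z : ℂ} (hz : z.im ≠ 0) (f : L2R6) {σ : Coupled}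
    (hσ : (channelParam β z σ).im ≠ 0) :
    comConj (twoParticleResolvent β hz) (tensorKet (comUnitary f) σ) =
      tensorKet (comUnitary (freeResolvent hσ f)) σ := by
  change comCoupledMap (twoParticleResolvent β hz
    (ContinuousLinearMap.adjoint comCoupledMap (tensorKet (comUnitary f) σ))) = _
  rw [adjoint_comCoupledMap_tensorKet, ← comCoupledMap_coupledVec]
  congr 1
  ext1 s
  change fourierMul (memLp_top_resolvent β hz s) (clebschGordan s.1 s.2 σ • f) =
    clebschGordan s.1 s.2 σ • freeResolvent hσ f
  rw [map_smul]
  by_cases h : clebschGordan s.1 s.2 σ = 0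
  · rw [h, zero_smul, zero_smul]
  · rw [twoParticleResolvent_component β hz hσ h]

theorem sum_tensorKet_apply (g : Coupled → L2R6) (τ : Coupled) :
    (∑ σ, tensorKet (g σ) σ) τ = g τ := by
  have h : (∑ σ, tensorKet (g σ) σ) τ = ∑ σ, tensorKet (g σ) σ τ := by
    rw [WithLp.ofLp_sum, Finset.sum_apply]
  rw [h, Finset.sum_eq_single τ]
  · simp [tensorKet]
  · intro σ _ hσ
    simp [tensorKet, hσ.symm]
  · simp

/-- The Green function of the two-particle operator. -/
def greenKernel (β : ℝ) (z : ℂ) (σ' σ : Coupled) (Q : R6) : ℂ :=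
  kron σ' σ * freeKernel (csqrt (-channelParam β z σ)) Q

theorem csqrt_channelParam_re_pos (β : ℝ) {z : ℂ} (hz : z.im ≠ 0) (σ : Coupled) :
    0 < (csqrt (-channelParam β z σ)).re :=
  csqrt_re_pos (by rwa [neg_im, channelParam_im, neg_ne_zero])

theorem locallyIntegrable_greenKernel (β : ℝ) {z : ℂ} (hz : z.im ≠ 0) (σ' σ : Coupled) :
    LocallyIntegrable (greenKernel β z σ' σ) :=
  ((integrable_freeKernel (csqrt_channelParam_re_pos β hz σ)).const_mul _).locallyIntegrable

theorem isLimConv_zero (f : L2R6) : IsLimConv (fun _ => 0) f 0 := by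
  refine ⟨fun r => Eventually.of_forall fun Q => by simp, ?_⟩
  have h : ∀ r : ℝ, eLpNorm (fun Q : R6 => (∫ Q' in Metric.closedBall (0 : R6) r,
      (0 : ℂ) * f Q') - (0 : L2R6) Q) 2 volume = 0 := by
    intro r
    rw [← eLpNorm_zero (p := 2) (μ := (volume : Measure R6)) (ε := ℂ)]
    refine eLpNorm_congr_ae ?_
    exact Eventually.of_forall fun Q => by simp
  simp_rw [h]
  exact tendsto_const_nhds

theorem isLimConv_greenKernel (β : ℝ) {z : ℂ} {σ : Coupled}
    (hσ : (channelParam β z σ).im ≠ 0) (f : L2R6) (σ' : Coupled) :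
    IsLimConv (greenKernel β z σ' σ) f (if σ' = σ then freeResolvent hσ f else 0) := by
  by_cases h : σ' = σ
  · have hk : greenKernel β z σ' σ = freeKernel (csqrt (-channelParam β z σ)) := by
      ext Q
      simp [greenKernel, kron, h]
    rw [hk, if_pos h]
    exact isLimConv_freeResolvent hσ f
  · have hk : greenKernel β z σ' σ = fun _ => 0 := by
      ext Q
      simp [greenKernel, kron, h]
    rw [hk, if_neg h]
    exact isLimConv_zero f

theorem isGreenFunction_greenKernel (β : ℝ) {z : ℂ} (hz : z.im ≠ 0) :
    IsGreenFunction 0 β z (greenKernel β z) := by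
  refine ⟨locallyIntegrable_greenKernel β hz, twoParticleResolvent β hz,
    isResolventAt_twoParticleOp β hz, fun f σ => ?_⟩
  have hσ : (channelParam β z σ).im ≠ 0 := by rwa [channelParam_im]
  refine ⟨fun σ' => if σ' = σ then freeResolvent hσ f else 0,
    isLimConv_greenKernel β hσ f, ?_⟩
  rw [comConj_resolvent β hz f hσ]
  ext1 τ
  rw [sum_tensorKet_apply]
  by_cases h : τ = σ
  · subst h
    simp [tensorKet]
  · simp [tensorKet, h]

theorem IsGreenFunction.ae_eq_greenKernel {β : ℝ} {z : ℂ} (hz : z.im ≠ 0)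
    {G : Coupled → Coupled → R6 → ℂ} (hG : IsGreenFunction 0 β z G) (σ' σ : Coupled) :
    G σ' σ =ᵐ[volume] greenKernel β z σ' σ := by
  obtain ⟨hloc, R, hR, hconv⟩ := hG
  obtain rfl := hR.unique (isResolventAt_twoParticleOp β hz)
  have hσ : (channelParam β z σ).im ≠ 0 := by rwa [channelParam_im]
  refine ae_eq_of_forall_isLimConv (hloc σ' σ) (locallyIntegrable_greenKernel β hz σ' σ)
    fun f => ?_
  obtain ⟨g, hg, heq⟩ := hconv f σ
  refine ⟨g σ', hg σ', ?_⟩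
  have hval : g σ' = if σ' = σ then freeResolvent hσ f else 0 := by
    refine comUnitary_injective ?_
    rw [comConj_resolvent β hz f hσ] at heq
    rw [← sum_tensorKet_apply (fun τ => comUnitary (g τ)) σ', ← heq]
    by_cases h : σ' = σ
    · subst h
      simp [tensorKet]
    · simp [tensorKet, h]
  rw [hval]
  exact isLimConv_greenKernel β hσ f σ'

theorem greenKernel_eq_macdonald (β : ℝ) {z : ℂ} (hz : z.im ≠ 0) (σ' σ : Coupled) :
    ∀ᵐ Q : R6, greenKernel β z σ' σ Q =
      -(kron σ' σ / (8 * (Real.pi : ℂ) ^ 3 * (‖Q‖ : ℂ) ^ 2)) *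
        (channelParam β z σ * macdonald 2 (‖Q‖ * csqrt (-channelParam β z σ))) := by
  filter_upwards [freeKernel_eq_macdonald (csqrt_channelParam_re_pos β hz σ)] with Q hQ
  rw [greenKernel, hQ, csqrt_sq]
  ring

end

end Rashba

theorem proposition4p1 (β : ℝ) (hβ : 0 ≤ β) (z : ℂ) (hz : z.im ≠ 0) :
    (∃ G : Coupled → Coupled → R6 → ℂ, IsGreenFunction 0 β z G) ∧
    ∀ G : Coupled → Coupled → R6 → ℂ, IsGreenFunction 0 β z G →
      (∀ σ' σ : Coupled, ∀ᵐ Q : R6,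
        G σ' σ Q = -(kron σ' σ / (8 * (Real.pi : ℂ) ^ 3 * (‖Q‖ : ℂ) ^ 2)) *
          (kron σ.s 0 * z * macdonald 2 (‖Q‖ * csqrt (-z))
            + kron σ.S 1 *
              (kron σ.s 1 * (z - 2 * β) * macdonald 2 (‖Q‖ * csqrt (2 * β - z))
                + kron σ.s (-1) * (z + 2 * β) * macdonald 2 (‖Q‖ * csqrt (-(2 * β) - z))))) ∧
      (β = 0 → ∀ σ' σ : Coupled, ∀ᵐ Q : R6,
        G σ' σ Q = -kron σ' σ *
          (z * macdonald 2 (‖Q‖ * csqrt (-z)) / (8 * (Real.pi : ℂ) ^ 3 * (‖Q‖ : ℂ) ^ 2))) := by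
  refine ⟨⟨greenKernel β z, isGreenFunction_greenKernel β hz⟩, fun G hG => ⟨fun σ' σ => ?_, ?_⟩⟩
  · filter_upwards [hG.ae_eq_greenKernel hz σ' σ, greenKernel_eq_macdonald β hz σ' σ] with Q h1 h2
    rw [h1, h2]
    congr 1
    have e1 : -(z - 2 * (β : ℂ)) = 2 * β - z := by ring
    have e2 : -(z + 2 * (β : ℂ)) = -(2 * β) - z := by ring
    rw [← e1, ← e2]
    cases σ <;> simp [channelParam, kron, Coupled.s, Coupled.S]
  · rintro rfl σ' σ
    filter_upwards [hG.ae_eq_greenKernel hz σ' σ, greenKernel_eq_macdonald 0 hz σ' σ] with Q h1 h2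
    have hc : channelParam 0 z σ = z := by simp [channelParam]
    rw [h1, h2, hc]
    ring
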